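/- Let $G\subset\mathbb{C}$ be a simply connected domain with $0\notin G$, and let $H(G)$ be the space of holomorphic functions on $G$ with the topology of uniform convergence on compact subsets of $G$. For $n\in\mathbb{N}$ let $\widetilde{T}_n:H(G)\to H(G)$ be the continuous linear operator $$\widetilde{T}_n(f)(\zeta)=\sum_{j=0}^{n}\frac{f^{(j)}(\zeta)}{j!}(-\zeta)^j,\qquad \zeta\in G.$$ Let $\sigma_0\ge 1$ and let $(\lambda^{(\sigma)}_n)_n$, $\sigma=1,\dots,\sigma_0$, be sequences of positive integers such that $$\lim_{n}\lambda^{(1)}_n=+\infty\quad\text{and}\quad \lim_n\frac{\lambda^{(\sigma+1)}_n}{\lambda^{(\sigma)}_n}=+\infty\quad\text{for }\sigma=1,\dots,\sigma_0-1.$$ Then the sequence of continuous linear operators $D_n:H(G)\to H(G)^{\sigma_0}$, $$D_n(f)=\bigl(\widetilde{T}_{\lambda^{(1)}_n}(f),\widetilde{T}_{\lambda^{(2)}_n}(f),\dots,\widetilde{T}_{\lambda^{(\sigma_0)}_n}(f)\bigr),$$ is universal: there exists $f\in H(G)$ such that the set $\{D_n(f): n\ge 1\}$ is dense in $H(G)^{\sigma_0}$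 with the product topology. -/

import Mathlib

open Filter Topology TopologicalSpace

noncomputable section

/-- A sequence of continuous linear operators `T n : X → Y` between topological vector spaces is
universal (hypercyclic) if some vector `x` has a dense orbit `{T n x : n}` in `Y`. -/
def IsUniversal {𝕜 X Y : Type*} [Semiring 𝕜]
    [AddCommMonoid X] [TopologicalSpace X] [Module 𝕜 X]
    [AddCommMonoid Y] [TopologicalSpace Y] [Module 𝕜 Y]
    (T : ℕ → X →L[𝕜] Y) : Prop :=
  ∃ x : X, Dense (Set.range fun n => T n x)

/-- Extension by zero to the whole plane of a function on the open set `G`. Only the values on `G`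
matter: since `G` is open, derivatives at points of `G` do not see the extension. -/
def extendZero {G : Opens ℂ} (f : G → ℂ) : ℂ → ℂ :=
  Function.extend Subtype.val f 0

theorem extendZero_coe {G : Opens ℂ} (f : G → ℂ) (z : G) : extendZero f z = f z :=
  Subtype.val_injective.extend_apply f 0 z

theorem extendZero_add {G : Opens ℂ} (f g : G → ℂ) :
    extendZero (f + g) = extendZero f + extendZero g := by
  funext z
  by_cases hz : z ∈ G
  · have h := fun u : G → ℂ => extendZero_coe u ⟨z, hz⟩
    simp only at h
    simp [h]
  · have h : ∀ u : G → ℂ, extendZero u z = 0 := fun u =>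
      Function.extend_apply' _ _ _ (fun ⟨a, ha⟩ => hz (ha ▸ a.2))
    simp [h]

theorem extendZero_smul {G : Opens ℂ} (c : ℂ) (f : G → ℂ) :
    extendZero (c • f) = c • extendZero f := by
  funext z
  by_cases hz : z ∈ G
  · have h := fun u : G → ℂ => extendZero_coe u ⟨z, hz⟩
    simp only at h
    simp [h]
  · have h : ∀ u : G → ℂ, extendZero u z = 0 := fun u =>
      Function.extend_apply' _ _ _ (fun ⟨a, ha⟩ => hz (ha ▸ a.2))
    simp [h]

/-- The space `H(G)` of holomorphic functions on the open set `G ⊆ ℂ`, as a subspace of `C(G, ℂ)`.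
It inherits the compact-open topology of `C(G, ℂ)`, which is the topology of uniform convergence on
the compact subsets of `G`. -/
def HolSpace (G : Opens ℂ) : Submodule ℂ C(G, ℂ) where
  carrier := {f | DifferentiableOn ℂ (extendZero f) G}
  add_mem' {f g} hf hg := by
    change DifferentiableOn ℂ (extendZero (f + g : G → ℂ)) G
    rw [extendZero_add]
    exact DifferentiableOn.add hf hg
  zero_mem' := by
    have h : extendZero (0 : G → ℂ) = fun _ => 0 := by
      have := extendZero_smul (G := G) 0 0
      simpa [funext_iff] using this
    change DifferentiableOn ℂ (extendZero (0 : G → ℂ)) G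
    rw [h]
    exact differentiableOn_const 0
  smul_mem' c f hf := by
    change DifferentiableOn ℂ (extendZero (c • (f : G → ℂ))) G
    rw [extendZero_smul]
    exact DifferentiableOn.const_smul hf c

/-- The function `ℂ → ℂ` equal to `f ∈ H(G)` on `G` and to zero elsewhere. -/
def holFun {G : Opens ℂ} (f : HolSpace G) : ℂ → ℂ := extendZero (f : C(G, ℂ))

theorem holFun_differentiableOn {G : Opens ℂ} (f : HolSpace G) :
    DifferentiableOn ℂ (holFun f) G := f.2

/-- A function that is complex differentiable on `G`, as an element of `H(G)`. -/
def HolSpace.mk {G : Opens ℂ} (g : ℂ → ℂ) (hg : DifferentiableOn ℂ g G) : HolSpace G :=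
  ⟨⟨fun z => g z, hg.continuousOn.domRestrict⟩,
    hg.congr fun z hz => extendZero_coe (fun w : G => g w) ⟨z, hz⟩⟩

theorem HolSpace.tendsto_iff {G : Opens ℂ} {ι : Type*} {l : Filter ι} (F : ι → HolSpace G)
    (f : HolSpace G) : Tendsto F l (𝓝 f) ↔
      TendstoLocallyUniformlyOn (fun i => holFun (F i)) (holFun f) l (G : Set ℂ) := by
  have : LocallyCompactSpace G := G.isOpen.locallyCompactSpace
  rw [tendsto_subtype_rng, ContinuousMap.tendsto_iff_tendstoLocallyUniformly,
    tendstoLocallyUniformlyOn_iff_tendstoLocallyUniformly_comp_coe]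
  have h : ∀ (u : HolSpace G) (z : G), (holFun u) z = (u : C(G, ℂ)) z := fun u z =>
    extendZero_coe _ z
  have h2 : (holFun f) ∘ ((↑) : G → ℂ) = (f : C(G, ℂ)) := funext (h f)
  have h3 : (fun i (z : G) => holFun (F i) z) = fun i z => (F i : C(G, ℂ)) z :=
    funext fun i => funext (h (F i))
  exact (by rw [← h2, ← h3]; exact Iff.rfl)

theorem differentiableOn_iteratedDeriv {G : Opens ℂ} {f : ℂ → ℂ} (hf : DifferentiableOn ℂ f G)
    (j : ℕ) : DifferentiableOn ℂ (iteratedDeriv j f) G := by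
  induction j with
  | zero => simpa using hf
  | succ j ih => rw [iteratedDeriv_succ]; exact ih.deriv G.isOpen

theorem tendstoLocallyUniformlyOn_iteratedDeriv {G : Opens ℂ} {ι : Type*} {l : Filter ι}
    {F : ι → ℂ → ℂ} {f : ℂ → ℂ} (hF : ∀ i, DifferentiableOn ℂ (F i) G)
    (h : TendstoLocallyUniformlyOn F f l (G : Set ℂ)) (j : ℕ) :
    TendstoLocallyUniformlyOn (fun i => iteratedDeriv j (F i)) (iteratedDeriv j f) l
      (G : Set ℂ) := by
  induction j with
  | zero => simpa using h
  | succ j ih =>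
    simp only [iteratedDeriv_succ]
    exact ih.deriv (Eventually.of_forall fun i => differentiableOn_iteratedDeriv (hF i) j) G.isOpen

/-- The expression `∑_{j ≤ n} f^{(j)}(ζ) / j! * (-ζ)^j`. -/
def taylorAtZero (n : ℕ) (f : ℂ → ℂ) (ζ : ℂ) : ℂ :=
  ∑ j ∈ Finset.range (n + 1), iteratedDeriv j f ζ / (j.factorial : ℂ) * (-ζ) ^ j

theorem differentiableOn_taylorAtZero {G : Opens ℂ} {f : ℂ → ℂ} (hf : DifferentiableOn ℂ f G)
    (n : ℕ) : DifferentiableOn ℂ (taylorAtZero n f) G := by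
  unfold taylorAtZero
  refine DifferentiableOn.fun_sum fun j _ => ?_
  exact ((differentiableOn_iteratedDeriv hf j).div_const _).mul
    ((differentiable_id.neg.pow j).differentiableOn)

theorem tendstoLocallyUniformlyOn_taylorAtZero {G : Opens ℂ} {ι : Type*} {l : Filter ι}
    {F : ι → ℂ → ℂ} {f : ℂ → ℂ} (hF : ∀ i, DifferentiableOn ℂ (F i) G)
    (hf : DifferentiableOn ℂ f G)
    (h : TendstoLocallyUniformlyOn F f l (G : Set ℂ)) (n : ℕ) :
    TendstoLocallyUniformlyOn (fun i => taylorAtZero n (F i)) (taylorAtZero n f) l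
      (G : Set ℂ) := by
  have key : ∀ j : ℕ, TendstoLocallyUniformlyOn
      (fun i ζ => iteratedDeriv j (F i) ζ / (j.factorial : ℂ) * (-ζ) ^ j)
      (fun ζ => iteratedDeriv j f ζ / (j.factorial : ℂ) * (-ζ) ^ j) l (G : Set ℂ) := by
    intro j
    have h1 := tendstoLocallyUniformlyOn_iteratedDeriv hF h j
    have hc : Continuous fun ζ : ℂ => (-ζ) ^ j / (j.factorial : ℂ) := by fun_prop
    have h2 : TendstoLocallyUniformlyOn (fun (_ : ι) (ζ : ℂ) => (-ζ) ^ j / (j.factorial : ℂ))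
        (fun ζ => (-ζ) ^ j / (j.factorial : ℂ)) l (G : Set ℂ) := by
      intro u hu x _
      exact ⟨Set.univ, univ_mem, Eventually.of_forall fun _ _ _ => refl_mem_uniformity hu⟩
    have h3 := h1.mul₀ h2 (differentiableOn_iteratedDeriv hf j).continuousOn hc.continuousOn
    refine (h3.congr fun i ζ _ => ?_).congr_right fun ζ _ => ?_
    · simp only [Pi.mul_apply]; ring
    · simp only [Pi.mul_apply]; ring
  unfold taylorAtZero
  induction n with
  | zero => simpa using key 0
  | succ n ih =>
    simp only [Finset.sum_range_succ _ (n + 1)]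
    exact ih.add (key (n + 1))

/-- The continuous linear operator `T̃ₙ : H(G) → H(G)`,
`T̃ₙ(f)(ζ) = ∑_{j=0}^{n} f^{(j)}(ζ) / j! * (-ζ)^j` for `ζ ∈ G`. -/
def tTilde (G : Opens ℂ) (n : ℕ) : HolSpace G →L[ℂ] HolSpace G where
  toFun f := HolSpace.mk (taylorAtZero n (holFun f)) (differentiableOn_taylorAtZero (holFun_differentiableOn f) n)
  map_add' f g := by
    apply Subtype.ext
    ext z
    change taylorAtZero n (extendZero ((f : C(G, ℂ)) + (g : C(G, ℂ)) : G → ℂ)) z =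
      taylorAtZero n (holFun f) z + taylorAtZero n (holFun g) z
    have hc : ∀ (u : HolSpace G) (j : ℕ), ContDiffAt ℂ j (holFun u) z := fun u j =>
      ((holFun_differentiableOn u).analyticAt (G.isOpen.mem_nhds z.2)).contDiffAt
    rw [extendZero_add]
    unfold taylorAtZero
    rw [← Finset.sum_add_distrib]
    refine Finset.sum_congr rfl fun j _ => ?_
    rw [show iteratedDeriv j (extendZero (f : C(G, ℂ)) + extendZero (g : C(G, ℂ))) (z : ℂ) =
      iteratedDeriv j (holFun f) z + iteratedDeriv j (holFun g) z from
      iteratedDeriv_add (hc f j) (hc g j)]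
    ring
  map_smul' c f := by
    apply Subtype.ext
    ext z
    change taylorAtZero n (extendZero (c • ((f : C(G, ℂ)) : G → ℂ))) z =
      c * taylorAtZero n (holFun f) z
    rw [extendZero_smul]
    unfold taylorAtZero
    rw [Finset.mul_sum]
    refine Finset.sum_congr rfl fun j _ => ?_
    rw [iteratedDeriv_const_smul_field, smul_eq_mul]
    change c * iteratedDeriv j (holFun f) z / _ * _ = _
    ring
  cont := by
    rw [continuous_iff_continuousAt]
    intro f
    have h := (HolSpace.tendsto_iff (fun g : HolSpace G => g) f).1 (tendsto_id (x := 𝓝 f))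
    refine (HolSpace.tendsto_iff _ _).2 ?_
    have h2 := tendstoLocallyUniformlyOn_taylorAtZero (fun g => holFun_differentiableOn g)
      (holFun_differentiableOn f) h n
    refine (h2.congr fun g ζ hζ => ?_).congr_right fun ζ hζ => ?_
    · exact (extendZero_coe (fun w : G => taylorAtZero n (holFun g) w) ⟨ζ, hζ⟩).symm
    · exact (extendZero_coe (fun w : G => taylorAtZero n (holFun f) w) ⟨ζ, hζ⟩).symm

/-- The defining formula of `T̃ₙ`, for a holomorphic function given by any representative `g` on the
plane. -/
theorem tTilde_mk_apply (G : Opens ℂ) (n : ℕ) (g : ℂ → ℂ) (hg : DifferentiableOn ℂ g G) (ζ : G) :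
    (tTilde G n (HolSpace.mk g hg) : C(G, ℂ)) ζ =
      ∑ j ∈ Finset.range (n + 1), iteratedDeriv j g ζ / (j.factorial : ℂ) * (-(ζ : ℂ)) ^ j := by
  change taylorAtZero n (extendZero fun w : G => g w) ζ = _
  have h : (extendZero fun w : G => g w) =ᶠ[𝓝 (ζ : ℂ)] g := by
    filter_upwards [G.isOpen.mem_nhds ζ.2] with z hz
    exact extendZero_coe (fun w : G => g w) ⟨z, hz⟩
  unfold taylorAtZero
  exact Finset.sum_congr rfl fun j _ => by rw [h.iteratedDeriv_eq j]

/-- The continuous linear operator `f ↦ (T̃_{m 1} f, …, T̃_{m s} f)` from `H(G)` to `H(G)^s`, where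
the target carries the product topology. -/
def tTildeTuple (G : Opens ℂ) {s : ℕ} (m : Fin s → ℕ) : HolSpace G →L[ℂ] (Fin s → HolSpace G) :=
  ContinuousLinearMap.pi fun σ => tTilde G (m σ)

end

/-! The operators are simultaneously diagonal on powers: `T̃ₙ(z^β) = ∏_{j≤n} (1 - β/j) z^β`. For `β
= is` with `s` real the eigenvalue stays bounded in `n` and behaves like `n^{-is} / Γ(1 - is)`. On a
superposition `∫₁² χ(s) z^{is} ds` (`powInt`), `T̃ₙ` thus multiplies `χ` by a bounded factor
oscillating like `e^{-is log n}`, and by Riemann–Lebesgue the images tend to zero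
(`tendstoUniformlyOn_powInt_exp_mul`).

To reach a target `∫ χ_σ(s) z^{is} ds` in coordinate `σ`, add the perturbation with weight `e^{is
log λ_σ} Γ(1 - is) χ_σ(s)`. It tends to zero by Riemann–Lebesgue. Its image under `T̃_{λ_σ}` tends
to the target, while under `T̃_{λ_τ}`, `τ ≠ σ`, the phase `e^{is(log λ_σ - log λ_τ)}` survives and
kills the limit: this is where the ratios going to infinity matter. Birkhoff's criterion
(`exists_dense_range_of_transitive`) then gives a universal function.

It remains to see that superpositions are dense in `H(G)` (`exists_powInt_norm_sub_lt`). Writing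
`z^{is} = e^{isL}` with `L` a logarithm on `G`, differentiation in `s` puts all `L^k e^{3iL/2}` in
their closure. Polynomials in `L` suffice by Runge's theorem on `L(G)`, which is obtained from
spectral theory in a closed subalgebra of `C(K)` and the Cauchy–Pompeiu formula. -/

/-! ### Logarithms and holes of compact plane sets -/

/-- A zero-free `F` on the plane has a continuous logarithm. Along a large circle about `a`,
uniqueness of lifts through `exp` forces it to grow by `2πi` in one turn, although it must return to
its initial value. -/
theorem not_exists_continuous_ne_zero_eq_sub (a : ℂ) (R : ℝ) (F : ℂ → ℂ) (hF : Continuous F)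
    (hF0 : ∀ z, F z ≠ 0) : ¬ ∀ z, R ≤ ‖z - a‖ → F z = z - a := by
  intro h
  have hsc : IsSimplyConnected (Set.univ : Set ℂ) := by
    have : SimplyConnectedSpace (Set.univ : Set ℂ) :=
      (Homeomorph.Set.univ ℂ).toHomotopyEquiv.simplyConnectedSpace
    exact this
  obtain ⟨ℓ, hℓ, hexp⟩ := Complex.exists_continuousOn_eqOn_exp_comp hsc isOpen_univ
    hF.continuousOn (by rintro ⟨z, -, hz⟩; exact hF0 z hz)
  have hℓ : Continuous ℓ := continuousOn_univ.1 hℓ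
  set r : ℝ := max R 1
  have hr : 0 < r := lt_of_lt_of_le one_pos (le_max_right _ _)
  let p : ℝ → ℂ := fun θ => a + r * Complex.exp (θ * Complex.I)
  have hp : Continuous p := by fun_prop
  have hFp : ∀ θ, Complex.exp (ℓ (p θ)) = r * Complex.exp (θ * Complex.I) := by
    intro θ
    have h1 := hexp (Set.mem_univ (p θ))
    simp only [Function.comp_apply] at h1
    rw [h1, h (p θ)]
    · simp [p]
    · simp [p, Complex.norm_exp_ofReal_mul_I, abs_of_pos hr, r]
  let g : ℝ → ℂ := fun θ => ℓ (p 0) + θ * Complex.I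
  have key : (fun θ => ℓ (p θ)) = g := by
    refine Complex.isCoveringMap_exp.eq_of_comp_eq (hℓ.comp hp) (by fun_prop) ?_ 0 (by simp [g])
    funext θ
    apply Subtype.ext
    simp only [Function.comp_apply, g, Complex.exp_add, hFp]
    simp
  have h1 := congrFun key (2 * Real.pi)
  have h2 : p (2 * Real.pi) = p 0 := by simp [p]
  simp only [h2, g] at h1
  have : ((2 * Real.pi : ℝ) : ℂ) * Complex.I = 0 := by linear_combination -h1
  simp [Real.pi_ne_zero] at this

/-- If `z - a` has a continuous logarithm on the compact set `K`, then `a` is in an unbounded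
component of the complement of `K`. -/
theorem not_isBounded_connectedComponentIn_of_log {K : Set ℂ} (hK : IsCompact K) {a : ℂ}
    (ha : a ∉ K) {ℓ : ℂ → ℂ} (hℓ : ContinuousOn ℓ K) (hexp : ∀ z ∈ K, Complex.exp (ℓ z) = z - a) :
    ¬ Bornology.IsBounded (connectedComponentIn Kᶜ a) := by
  classical
  intro hb
  set V := connectedComponentIn Kᶜ a
  have hVo : IsOpen V := hK.isClosed.isOpen_compl.connectedComponentIn
  have haV : a ∈ V := mem_connectedComponentIn ha
  -- Components of the open set `Kᶜ` are open, so a boundary point of one outside `K` would lie in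
  -- that same component.
  have hfr : ∀ z ∈ frontier V, z ∈ K := by
    intro z hz
    by_contra hzK
    have hWo : IsOpen (connectedComponentIn Kᶜ z) := hK.isClosed.isOpen_compl.connectedComponentIn
    have hzW : z ∈ connectedComponentIn Kᶜ z := mem_connectedComponentIn hzK
    obtain ⟨y, hyW, hyV⟩ := mem_closure_iff.1 hz.1 _ hWo hzW
    have e1 := connectedComponentIn_eq hyW
    have e2 := connectedComponentIn_eq hyV
    have : z ∈ V := by rw [show V = _ from e2, ← e1]; exact hzW
    rw [hVo.frontier_eq] at hz
    exact hz.2 this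
  obtain ⟨ℓ', hℓ'⟩ := ContinuousMap.exists_restrict_eq hK.isClosed
    (⟨K.domRestrict ℓ, continuousOn_iff_continuous_domRestrict.1 hℓ⟩ : C(K, ℂ))
  have hℓ'' : ∀ z ∈ K, ℓ' z = ℓ z := fun z hz => DFunLike.congr_fun hℓ' ⟨z, hz⟩
  obtain ⟨R, hR⟩ := hb.subset_ball a
  -- Glue `exp` of a Tietze extension of the logarithm, inside `V`, to `z - a` outside. The two
  -- agree on the frontier, which lies in `K`, and the only zero of `z - a` is in `V`.
  refine not_exists_continuous_ne_zero_eq_sub a R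
    (V.piecewise (fun z => Complex.exp (ℓ' z)) (fun z => z - a)) ?_ ?_ ?_
  · refine Continuous.piecewise ?_ (by fun_prop) (by fun_prop)
    intro z hz
    rw [hℓ'' z (hfr z hz), hexp z (hfr z hz)]
  · intro z
    by_cases hz : z ∈ V
    · simp [hz, Complex.exp_ne_zero]
    · rw [Set.piecewise_eq_of_notMem _ _ _ hz]
      intro h0
      rw [sub_eq_zero.1 h0] at hz
      exact hz haV
  · intro z hz
    rw [Set.piecewise_eq_of_notMem]
    intro hzV
    have := hR hzV
    rw [Metric.mem_ball, dist_eq_norm] at this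
    linarith

/-- The union of a plane set with the bounded components of its complement. -/
def fillHoles (K : Set ℂ) : Set ℂ := {z | Bornology.IsBounded (connectedComponentIn Kᶜ z)}

theorem mem_fillHoles {K : Set ℂ} {z : ℂ} :
    z ∈ fillHoles K ↔ Bornology.IsBounded (connectedComponentIn Kᶜ z) := Iff.rfl

theorem subset_fillHoles (K : Set ℂ) : K ⊆ fillHoles K := by
  intro z hz
  have : connectedComponentIn Kᶜ z = ∅ := connectedComponentIn_eq_empty (by simpa using hz)
  simp [fillHoles, this]

theorem connectedComponentIn_subset_compl_fillHoles {K : Set ℂ} {z : ℂ} (hz : z ∉ fillHoles K) :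
    connectedComponentIn Kᶜ z ⊆ (fillHoles K)ᶜ := by
  intro y hy hy'
  rw [mem_fillHoles, ← connectedComponentIn_eq hy] at hy'
  exact hz hy'

theorem not_isBounded_connectedComponentIn_compl_fillHoles {K : Set ℂ} {z : ℂ}
    (hz : z ∉ fillHoles K) :
    ¬ Bornology.IsBounded (connectedComponentIn (fillHoles K)ᶜ z) := by
  intro hb
  have hzK : z ∈ Kᶜ := fun h => hz (subset_fillHoles K h)
  exact hz (hb.subset (isPreconnected_connectedComponentIn.subset_connectedComponentIn
    (mem_connectedComponentIn hzK) (connectedComponentIn_subset_compl_fillHoles hz)))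

theorem isCompact_fillHoles {K : Set ℂ} (hK : IsCompact K) : IsCompact (fillHoles K) := by
  refine Metric.isCompact_of_isClosed_isBounded ?_ ?_
  · rw [← isOpen_compl_iff, isOpen_iff_mem_nhds]
    intro z hz
    have hzK : z ∈ Kᶜ := fun h => hz (subset_fillHoles K h)
    exact mem_of_superset (hK.isClosed.isOpen_compl.connectedComponentIn.mem_nhds
      (mem_connectedComponentIn hzK)) (connectedComponentIn_subset_compl_fillHoles hz)
  · obtain ⟨R, hR⟩ := hK.isBounded.subset_closedBall 0
    refine (Metric.isBounded_closedBall (x := (0 : ℂ)) (r := max R 0)).subset fun z hz => ?_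
    by_contra hzR
    rw [Metric.mem_closedBall, dist_zero_right, not_le, max_lt_iff] at hzR
    -- Outside a disc containing `K`, the radial ray from `z` to infinity avoids `K`, so the
    -- component of `z` is unbounded.
    have hsub : (fun t : ℝ => (t : ℂ) * z) '' Set.Ici 1 ⊆ connectedComponentIn Kᶜ z := by
      refine IsPreconnected.subset_connectedComponentIn
        (isPreconnected_Ici.image _ (by fun_prop)) ⟨1, by simp⟩ ?_
      rintro _ ⟨t, ht, rfl⟩ hK'
      have h1 := hR hK'
      rw [Set.mem_Ici] at ht
      simp only [Metric.mem_closedBall, dist_zero_right, norm_mul, Complex.norm_real,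
        Real.norm_eq_abs, abs_of_pos (one_pos.trans_le ht)] at h1
      nlinarith [hzR.1, hzR.2]
    obtain ⟨M, hM⟩ := ((mem_fillHoles.1 hz).subset hsub).exists_norm_le
    have h2 := hM _ ⟨max 1 ((M + 1) / ‖z‖), Set.mem_Ici.2 (le_max_left _ _), rfl⟩
    simp only [norm_mul, Complex.norm_real, Real.norm_eq_abs] at h2
    have h3 : (M + 1) / ‖z‖ * ‖z‖ ≤ |max 1 ((M + 1) / ‖z‖)| * ‖z‖ := by
      gcongr
      exact (le_max_right _ _).trans (le_abs_self _)
    rw [div_mul_cancel₀ _ hzR.2.ne'] at h3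
    linarith

theorem fillHoles_subset {K Ω : Set ℂ} (hK : IsCompact K) (hKΩ : K ⊆ Ω)
    (hlog : ∀ a ∉ Ω, ∃ ℓ : ℂ → ℂ, ContinuousOn ℓ Ω ∧ ∀ z ∈ Ω, Complex.exp (ℓ z) = z - a) :
    fillHoles K ⊆ Ω := by
  intro a ha
  by_contra haΩ
  obtain ⟨ℓ, hℓ, hexp⟩ := hlog a haΩ
  exact not_isBounded_connectedComponentIn_of_log hK (fun h => haΩ (hKΩ h)) (hℓ.mono hKΩ)
    (fun z hz => hexp z (hKΩ hz)) ha

/-! ### The Cauchy–Pompeiu formula -/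

/-- Twice the Wirtinger derivative `∂φ/∂z̄`. -/
noncomputable def dbar (φ : ℂ → ℂ) (ζ : ℂ) : ℂ := fderiv ℝ φ ζ 1 + Complex.I * fderiv ℝ φ ζ Complex.I

theorem continuous_dbar {φ : ℂ → ℂ} (hφ : ContDiff ℝ 1 φ) : Continuous (dbar φ) := by
  have := hφ.continuous_fderiv one_ne_zero
  unfold dbar
  fun_prop

theorem dbar_eq_zero {φ : ℂ → ℂ} {ζ : ℂ} (h : DifferentiableAt ℂ φ ζ) : dbar φ ζ = 0 := by
  have h1 := h.hasDerivAt.hasFDerivAt.restrictScalars ℝ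
  rw [dbar, h1.fderiv]
  simp only [ContinuousLinearMap.coe_restrictScalars', ContinuousLinearMap.toSpanSingleton_apply,
    smul_eq_mul, one_mul]
  linear_combination deriv φ ζ * Complex.I_mul_I

/-- At `ζ = r e^{iθ}` the two directional derivatives are `∂φ/∂r` and `r⁻¹ ∂φ/∂θ`, each of which can
be integrated explicitly. -/
theorem polar_decomposition_dbar (φ : ℂ → ℂ) (ζ : ℂ) (θ : ℝ) :
    Complex.exp (-(θ * Complex.I)) * dbar φ ζ =
      fderiv ℝ φ ζ (Complex.exp (θ * Complex.I)) +
        Complex.I * fderiv ℝ φ ζ (Complex.I * Complex.exp (θ * Complex.I)) := by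
  have e1 : Complex.exp (θ * Complex.I) = (Real.cos θ) • (1 : ℂ) + (Real.sin θ) • Complex.I := by
    rw [Complex.exp_mul_I]
    simp
  have e2 : Complex.I * Complex.exp (θ * Complex.I) =
      (-Real.sin θ) • (1 : ℂ) + (Real.cos θ) • Complex.I := by
    rw [e1]
    simp only [Complex.real_smul]
    push_cast
    linear_combination (Complex.sin θ) * Complex.I_mul_I
  have e3 : Complex.exp (-(θ * Complex.I)) = Real.cos θ - Real.sin θ * Complex.I := by
    rw [← neg_mul, ← Complex.ofReal_neg, Complex.exp_mul_I]
    simp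
    ring
  rw [e2, e3, e1]
  simp only [map_add, map_smul, dbar]
  simp only [Complex.real_smul]
  push_cast
  linear_combination (-Complex.sin θ * fderiv ℝ φ ζ Complex.I) * Complex.I_mul_I

open MeasureTheory in
/-- Cauchy–Pompeiu formula at the origin. -/
theorem integral_inv_mul_dbar {φ : ℂ → ℂ} (hφ : ContDiff ℝ 1 φ) (hs : HasCompactSupport φ) :
    ∫ ζ, ζ⁻¹ * dbar φ ζ = -(2 * Real.pi * φ 0) := by
  obtain ⟨R, hR0, hR⟩ : ∃ R : ℝ, 0 < R ∧ ∀ z, R ≤ ‖z‖ → φ z = 0 ∧ fderiv ℝ φ z = 0 := by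
    obtain ⟨R, hR⟩ := hs.isCompact.isBounded.subset_ball 0
    refine ⟨max R 1, by positivity, fun z hz => ?_⟩
    have hz' : z ∉ tsupport φ := fun h => by
      have := hR h
      rw [mem_ball_zero_iff] at this
      linarith [le_max_left R 1]
    exact ⟨image_eq_zero_of_notMem_tsupport hz',
      image_eq_zero_of_notMem_tsupport fun h => hz' (tsupport_fderiv_subset ℝ h)⟩
  have hfd := hφ.continuous_fderiv one_ne_zero
  -- In polar coordinates the Jacobian `r` cancels the modulus of `ζ⁻¹`, leaving the integrand `A +
  -- iB`. The radial part `A` integrates to `-φ 0` along each ray, and the angular part `B` to zero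
  -- around each circle.
  let A : ℝ × ℝ → ℂ := fun p => fderiv ℝ φ (p.1 * Complex.exp (p.2 * Complex.I))
    (Complex.exp (p.2 * Complex.I))
  let B : ℝ × ℝ → ℂ := fun p => fderiv ℝ φ (p.1 * Complex.exp (p.2 * Complex.I))
    (Complex.I * Complex.exp (p.2 * Complex.I))
  have hA : Continuous A := by
    refine Continuous.clm_apply ?_ (by fun_prop)
    exact hfd.comp (by fun_prop)
  have hB : Continuous B := by
    refine Continuous.clm_apply ?_ (by fun_prop)
    exact hfd.comp (by fun_prop)
  set S : Set (ℝ × ℝ) := Set.Ioc 0 R ×ˢ Set.Ioo (-Real.pi) Real.pi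
  have hSc : S ⊆ Set.Icc 0 R ×ˢ Set.Icc (-Real.pi) Real.pi :=
    Set.prod_mono Set.Ioc_subset_Icc_self Set.Ioo_subset_Icc_self
  have hAi : IntegrableOn A S :=
    (hA.continuousOn.integrableOn_compact (isCompact_Icc.prod isCompact_Icc)).mono_set hSc
  have hBi : IntegrableOn B S :=
    (hB.continuousOn.integrableOn_compact (isCompact_Icc.prod isCompact_Icc)).mono_set hSc
  have hray : ∀ θ : ℝ, ∫ r in Set.Ioc 0 R, A (r, θ) = -φ 0 := by
    intro θ
    rw [← intervalIntegral.integral_of_le hR0.le]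
    have hd : ∀ r ∈ Set.uIcc 0 R, HasDerivAt (fun r : ℝ => φ (r * Complex.exp (θ * Complex.I)))
        (A (r, θ)) r := by
      intro r _
      have h1 := (hφ.differentiable one_ne_zero (r * Complex.exp (θ * Complex.I))).hasFDerivAt
      have h2 : HasDerivAt (fun r : ℝ => (r : ℂ) * Complex.exp (θ * Complex.I))
          (Complex.exp (θ * Complex.I)) r := by
        simpa using (Complex.ofRealCLM.hasDerivAt (x := r)).mul_const (Complex.exp (θ * Complex.I))
      exact h1.comp_hasDerivAt r h2
    rw [intervalIntegral.integral_eq_sub_of_hasDerivAt hd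
      (Continuous.intervalIntegrable (by fun_prop) _ _)]
    have : φ (R * Complex.exp (θ * Complex.I)) = 0 := (hR _ (by
      simp [Complex.norm_exp_ofReal_mul_I, abs_of_pos hR0])).1
    simp [this]
  have hcirc : ∀ r ∈ Set.Ioc 0 R, ∫ θ in Set.Ioo (-Real.pi) Real.pi, B (r, θ) = 0 := by
    intro r hr
    rw [← integral_Ioc_eq_integral_Ioo,
      ← intervalIntegral.integral_of_le (by linarith [Real.pi_pos])]
    have hd : ∀ θ ∈ Set.uIcc (-Real.pi) Real.pi,
        HasDerivAt (fun θ : ℝ => φ (r * Complex.exp (θ * Complex.I))) (r * B (r, θ)) θ := by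
      intro θ _
      have h1 := (hφ.differentiable one_ne_zero (r * Complex.exp (θ * Complex.I))).hasFDerivAt
      have h2 : HasDerivAt (fun θ : ℝ => (r : ℂ) * Complex.exp (θ * Complex.I))
          (r • (Complex.I * Complex.exp (θ * Complex.I))) θ := by
        have := (((Complex.ofRealCLM.hasDerivAt (x := θ)).mul_const Complex.I).cexp).const_mul
          (r : ℂ)
        convert! this using 1
        simp only [Complex.real_smul, Complex.ofRealCLM_apply, Complex.ofReal_one]
        ring
      have h3 := h1.comp_hasDerivAt θ h2
      rwa [map_smul, Complex.real_smul] at h3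
    have h4 := intervalIntegral.integral_eq_sub_of_hasDerivAt hd
      (Continuous.intervalIntegrable (by fun_prop) _ _)
    rw [intervalIntegral.integral_const_mul] at h4
    have h5 : (r : ℂ) ≠ 0 := by exact_mod_cast hr.1.ne'
    refine (mul_eq_zero.1 (h4.trans ?_)).resolve_left h5
    rw [sub_eq_zero]
    simp [Complex.exp_neg, Complex.exp_pi_mul_I]
  have hprod : (volume : Measure (ℝ × ℝ)).restrict S =
      (volume.restrict (Set.Ioc 0 R)).prod (volume.restrict (Set.Ioo (-Real.pi) Real.pi)) := by
    rw [Measure.prod_restrict]; rfl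
  have hIA : ∫ p in S, A p = -(2 * Real.pi * φ 0) := by
    have h := hAi
    unfold IntegrableOn at h
    rw [hprod] at h ⊢
    rw [integral_prod_symm _ h]
    simp only [hray]
    rw [integral_const]
    simp [Real.pi_pos.le, ← two_mul]
  have hIB : ∫ p in S, B p = 0 := by
    have h := hBi
    unfold IntegrableOn at h
    rw [hprod] at h ⊢
    rw [integral_prod _ h]
    exact setIntegral_eq_zero_of_forall_eq_zero hcirc
  rw [← Complex.integral_comp_polarCoord_symm]
  have hsub : S ⊆ polarCoord.target := Set.prod_mono Set.Ioc_subset_Ioi_self le_rfl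
  have hpol : ∀ p : ℝ × ℝ, Complex.polarCoord.symm p = p.1 * Complex.exp (p.2 * Complex.I) := by
    intro p
    rw [Complex.polarCoord_symm_apply, Complex.exp_mul_I]
    simp
  rw [setIntegral_eq_of_subset_of_forall_sdiff_eq_zero polarCoord.open_target.measurableSet hsub]
  · rw [setIntegral_congr_fun (g := fun p => A p + Complex.I * B p)
      (measurableSet_Ioc.prod measurableSet_Ioo)]
    · rw [integral_add hAi (hBi.const_mul _), integral_const_mul, hIA, hIB]
      simp
    · rintro ⟨r, θ⟩ ⟨hr, -⟩
      have h5 : (r : ℂ) ≠ 0 := by exact_mod_cast hr.1.ne'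
      have := polar_decomposition_dbar φ (r * Complex.exp (θ * Complex.I)) θ
      simp only [hpol, A, B, ← this, Complex.real_smul, mul_inv, Complex.exp_neg]
      field_simp
  · rintro ⟨r, θ⟩ ⟨hr, hr'⟩
    have hrR : R ≤ r := by
      by_contra hlt
      exact hr' ⟨⟨hr.1, (not_le.1 hlt).le⟩, hr.2⟩
    have := (hR (r * Complex.exp (θ * Complex.I)) (by
      simpa [Complex.norm_exp_ofReal_mul_I] using hrR.trans (le_abs_self r))).2
    simp [hpol, dbar, this]

open MeasureTheory in
/-- Cauchy–Pompeiu formula for compactly supported functions. -/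
theorem integral_inv_sub_mul_dbar {φ : ℂ → ℂ} (hφ : ContDiff ℝ 1 φ) (hs : HasCompactSupport φ)
    (z : ℂ) : ∫ ζ, (ζ - z)⁻¹ * dbar φ ζ = -(2 * Real.pi * φ z) := by
  have h := integral_inv_mul_dbar (φ := fun ζ => φ (ζ + z)) (by fun_prop)
    (hs.comp_homeomorph (Homeomorph.addRight z))
  rw [zero_add] at h
  rw [← h, ← integral_add_right_eq_self _ z]
  congr 1
  funext ζ
  simp [dbar, fderiv_comp_add_right]

/-! ### Runge's theorem -/

theorem exists_contDiff_hasCompactSupport_eqOn {K U : Set ℂ} (hK : IsCompact K) (hU : IsOpen U)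
    (hKU : K ⊆ U) {f : ℂ → ℂ} (hf : DifferentiableOn ℂ f U) :
    ∃ φ : ℂ → ℂ, ContDiff ℝ 1 φ ∧ HasCompactSupport φ ∧ ∀ᶠ z in 𝓝ˢ K, φ z = f z := by
  obtain ⟨t, htc, hKt, htU⟩ := exists_compact_between hK hU hKU
  obtain ⟨χ, hχ1, hχ0, -⟩ := exists_contMDiffMap_one_nhds_of_subset_interior
    (n := 1) (modelWithCornersSelf ℝ ℂ) hK.isClosed hKt
  have hχ : ContDiff ℝ 1 χ := χ.contMDiff.contDiff
  refine ⟨fun z => χ z * f z, ?_, ?_, ?_⟩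
  · rw [contDiff_iff_contDiffAt]
    intro z
    by_cases hz : z ∈ U
    · have h1 : ContDiffAt ℂ 1 f z := (hf.analyticAt (hU.mem_nhds hz)).contDiffAt
      exact (Complex.ofRealCLM.contDiff.contDiffAt.comp z hχ.contDiffAt).mul
        (h1.restrict_scalars ℝ)
    · have h1 : (fun z => (χ z : ℂ) * f z) =ᶠ[𝓝 z] fun _ => 0 := by
        filter_upwards [htc.isClosed.isOpen_compl.mem_nhds fun h => hz (htU h)] with w hw
        simp [hχ0 w hw]
      exact contDiffAt_const.congr_of_eventuallyEq h1
  · exact HasCompactSupport.intro htc fun z hz => by simp [hχ0 z hz]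
  · filter_upwards [hχ1] with z hz
    simp [hz]

open MeasureTheory in
/-- Runge's theorem on a compact set without holes, in terms of the closed algebra generated by the
coordinate function. -/
theorem mem_elemental_of_differentiableOn {K U : Set ℂ} [CompactSpace K]
    (hK : ∀ z ∉ K, ¬ Bornology.IsBounded (connectedComponentIn Kᶜ z)) (hU : IsOpen U)
    (hKU : K ⊆ U) {f : ℂ → ℂ} (hf : DifferentiableOn ℂ f U) (x F : C(K, ℂ)) (hx : ∀ z, x z = z)
    (hF : ∀ z, F z = f z) : F ∈ Algebra.elemental ℂ x := by
  have hKc : IsCompact K := isCompact_iff_compactSpace.2 inferInstance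
  obtain ⟨φ, hφ, hφc, hφK⟩ := exists_contDiff_hasCompactSupport_eqOn hKc hU hKU hf
  let S := Algebra.elemental ℂ x
  let y : S := ⟨x, Algebra.elemental.self_mem ℂ x⟩
  have hσ : spectrum ℂ (y : C(K, ℂ)) = K := by
    rw [ContinuousMap.spectrum_eq_range]
    ext z
    constructor
    · rintro ⟨w, rfl⟩
      simp [y, hx]
    · intro hz
      exact ⟨⟨z, hz⟩, hx _⟩
  -- Passing to the closed subalgebra `S` can enlarge the spectrum only by filling holes of `K`.
  -- There are none, so the functions `(ζ - ·)⁻¹`, `ζ ∉ K`, all belong to `S`.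
  have hres : ∀ z ∉ K, z ∈ resolventSet ℂ y := by
    intro z hz
    by_contra h
    have := Subalgebra.spectrum_isBounded_connectedComponentIn (𝕜 := ℂ) S y (z := z) h
    rw [hσ] at this
    exact hK z hz this
  let ev : K → S →L[ℂ] ℂ := fun z =>
    (ContinuousMap.evalCLM ℂ z).comp (Subalgebra.toSubmodule S).subtypeL
  have hev : ∀ (z : K) (ζ : ℂ), ζ ∉ K → ev z (resolvent y ζ) = (ζ - z)⁻¹ := by
    intro z ζ hζ
    have h1 : (algebraMap ℂ S ζ - y) * resolvent y ζ = 1 := Ring.mul_inverse_cancel _ (hres ζ hζ)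
    have h2 := congrArg (fun u : S => (u : C(K, ℂ)) z) h1
    have h3 : (ζ - z) * ev z (resolvent y ζ) = 1 := by
      rw [← hx z]
      exact h2
    exact eq_inv_of_mul_eq_one_right h3
  have hψK : ∀ᶠ z in 𝓝ˢ K, dbar φ z = 0 := by
    have h1 : ∀ᶠ z in 𝓝ˢ K, z ∈ U := hU.mem_nhdsSet.2 hKU
    filter_upwards [hφK.eventually_nhdsSet, h1] with z hz hzU
    have h2 : φ =ᶠ[𝓝 z] f := hz
    exact dbar_eq_zero (h2.differentiableAt_iff.2 (hf.differentiableAt (hU.mem_nhds hzU)))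
  -- The Cauchy–Pompeiu integrand as an `S`-valued function, whose integral therefore stays in `S`.
  -- The resolvent has no meaning on `K`, but `dbar φ` vanishes near `K`, where `φ` is holomorphic.
  let g : ℂ → S := fun ζ => dbar φ ζ • resolvent y ζ
  have hgc : Continuous g := by
    rw [continuous_iff_continuousAt]
    intro ζ
    by_cases hζ : ζ ∈ K
    · have : g =ᶠ[𝓝 ζ] fun _ => 0 := by
        filter_upwards [hψK.filter_mono (nhds_le_nhdsSet hζ)] with w hw
        simp [g, hw]
      exact continuousAt_const.congr this.symm
    · exact (continuous_dbar hφ).continuousAt.smul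
        (spectrum.hasDerivAt_resolvent_const_left (hres ζ hζ)).continuousAt
  have hgs : HasCompactSupport g := by
    refine HasCompactSupport.intro hφc fun ζ hζ => ?_
    have : fderiv ℝ φ ζ = 0 :=
      image_eq_zero_of_notMem_tsupport fun h => hζ (tsupport_fderiv_subset ℝ h)
    simp [g, dbar, this]
  have hgi : Integrable g := hgc.integrable_of_hasCompactSupport hgs
  have key : ∀ z : K, ev z (∫ ζ, g ζ) = -(2 * Real.pi * f z) := by
    intro z
    rw [← (ev z).integral_comp_comm hgi, ← hφK.self_of_nhdsSet z z.2,
      ← integral_inv_sub_mul_dbar hφ hφc z]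
    congr 1
    funext ζ
    by_cases hζ : ζ ∈ K
    · simp [g, hψK.self_of_nhdsSet ζ hζ]
    · simp [g, hev z ζ hζ, mul_comm]
  have hpi : (2 * Real.pi : ℂ) ≠ 0 := by simp [Real.pi_ne_zero]
  have : F = (-(2 * Real.pi : ℂ)⁻¹ • ∫ ζ, g ζ : S) := by
    ext z
    have h1 : (((-(2 * Real.pi : ℂ)⁻¹ • ∫ ζ, g ζ : S) : C(K, ℂ)) z) =
      -(2 * Real.pi : ℂ)⁻¹ * ev z (∫ ζ, g ζ) := rfl
    rw [h1, key, hF]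
    field_simp
  rw [this]
  exact Subtype.prop _

theorem aeval_apply {X : Type*} [TopologicalSpace X] (x : C(X, ℂ)) (p : Polynomial ℂ) (z : X) :
    (Polynomial.aeval x p : C(X, ℂ)) z = p.eval (x z) := by
  have := Polynomial.aeval_algHom_apply (ContinuousMap.evalAlgHom ℂ ℂ z) x p
  rw [ContinuousMap.evalAlgHom_apply, ContinuousMap.evalAlgHom_apply] at this
  rw [← this, Polynomial.aeval_def, Polynomial.eval₂_eq_eval_map]
  simp

/-- Runge's theorem: if every `z - a`, `a ∉ Ω`, has a continuous logarithm on the open set `Ω`, then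
functions holomorphic on `Ω` are uniformly approximable by polynomials on compact subsets. -/
theorem exists_polynomial_norm_sub_lt {K Ω : Set ℂ} (hK : IsCompact K) (hΩ : IsOpen Ω)
    (hKΩ : K ⊆ Ω)
    (hlog : ∀ a ∉ Ω, ∃ ℓ : ℂ → ℂ, ContinuousOn ℓ Ω ∧ ∀ z ∈ Ω, Complex.exp (ℓ z) = z - a)
    {f : ℂ → ℂ} (hf : DifferentiableOn ℂ f Ω) {ε : ℝ} (hε : 0 < ε) :
    ∃ p : Polynomial ℂ, ∀ z ∈ K, ‖f z - p.eval z‖ < ε := by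
  have hsub := fillHoles_subset hK hKΩ hlog
  have : CompactSpace (fillHoles K) := isCompact_iff_compactSpace.1 (isCompact_fillHoles hK)
  let x : C(fillHoles K, ℂ) := ⟨Subtype.val, continuous_subtype_val⟩
  let F : C(fillHoles K, ℂ) := ⟨fun z => f z, (hf.continuousOn.mono hsub).domRestrict⟩
  have hmem := mem_elemental_of_differentiableOn
    (fun z hz => not_isBounded_connectedComponentIn_compl_fillHoles hz) hΩ hsub hf x F
    (fun _ => rfl) (fun _ => rfl)
  obtain ⟨q, hq, hdist⟩ := Metric.mem_closure_iff.1 (show F ∈ closure _ from hmem) ε hε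
  rw [SetLike.mem_coe, Algebra.adjoin_singleton_eq_range_aeval] at hq
  obtain ⟨p, rfl⟩ := hq
  refine ⟨p, fun z hz => ?_⟩
  have h1 := (ContinuousMap.dist_lt_iff hε).1 hdist ⟨z, subset_fillHoles K hz⟩
  rw [dist_eq_norm] at h1
  have h2 := aeval_apply x p ⟨z, subset_fillHoles K hz⟩
  change ‖f z - (Polynomial.aeval x p : C(fillHoles K, ℂ)) _‖ < ε at h1
  rwa [h2] at h1

/-! ### Density of superpositions of imaginary powers -/

theorem mem_of_hasDerivAt {E : Type*} [NormedAddCommGroup E] [NormedSpace ℂ E]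
    (M : Submodule ℂ E) (hM : IsClosed (M : Set E)) {c : ℝ → E} {c' : E} {s : ℝ}
    (hc : ∀ᶠ t in 𝓝 s, c t ∈ M) (hd : HasDerivAt c c' s) : c' ∈ M := by
  refine hM.mem_of_tendsto (hasDerivAt_iff_tendsto_slope.1 hd) ?_
  filter_upwards [hc.filter_mono nhdsWithin_le_nhds] with t ht
  rw [slope_def_module, ← Complex.coe_smul]
  exact M.smul_mem _ (M.sub_mem ht hc.self_of_nhds)

theorem hasDerivAt_exp_ofReal_smul {A : Type*} [NormedCommRing A] [NormedAlgebra ℂ A]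
    [CompleteSpace A] (x : A) (s : ℝ) : HasDerivAt (fun s : ℝ => NormedSpace.exp ((s : ℂ) • x))
      (x * NormedSpace.exp ((s : ℂ) • x)) s := by
  have h := (hasDerivAt_exp_smul_const' (𝕂 := ℂ) x (s : ℂ)).scomp s
    (Complex.ofRealCLM.hasDerivAt (x := s))
  simpa [Function.comp_def] using h

theorem continuous_exp_ofReal_smul {A : Type*} [NormedCommRing A] [NormedAlgebra ℂ A]
    [CompleteSpace A] (x : A) : Continuous fun s : ℝ => NormedSpace.exp ((s : ℂ) • x) :=
  continuous_iff_continuousAt.2 fun s => (hasDerivAt_exp_ofReal_smul x s).continuousAt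

/-- Indicator weights give `∫₁ᵗ e^{ux} du`, with derivative `e^{tx}`; every further derivative
brings down a factor `x`. A closed subspace is stable under such derivatives. -/
theorem pow_mul_exp_mem {A : Type*} [NormedCommRing A] [NormedAlgebra ℂ A] [CompleteSpace A]
    (M : Submodule ℂ A) (hM : IsClosed (M : Set A)) (x : A)
    (hx : ∀ χ : ℝ → ℂ, IntervalIntegrable χ MeasureTheory.volume 1 2 →
      ∫ s in (1 : ℝ)..2, χ s • NormedSpace.exp ((s : ℂ) • x) ∈ M) (k : ℕ) :
    ∀ s ∈ Set.Ioo (1 : ℝ) 2, x ^ k * NormedSpace.exp ((s : ℂ) • x) ∈ M := by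
  have hd := hasDerivAt_exp_ofReal_smul x
  have hcont := continuous_exp_ofReal_smul x
  induction k with
  | zero =>
    intro s hs
    rw [pow_zero, one_mul]
    refine mem_of_hasDerivAt M hM
      (c := fun t => ∫ u in (1 : ℝ)..t, NormedSpace.exp ((u : ℂ) • x)) ?_
      (intervalIntegral.integral_hasDerivAt_right (hcont.intervalIntegrable _ _)
        (hcont.stronglyMeasurableAtFilter _ _) hcont.continuousAt)
    filter_upwards [isOpen_Ioo.mem_nhds hs] with t ht
    have h1 := hx ({u | u ≤ t}.indicator fun _ => 1) ?_
    · convert! h1 using 1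
      rw [← intervalIntegral.integral_indicator (Set.Ioo_subset_Icc_self ht)]
      congr 1
      funext u
      by_cases hu : u ≤ t <;> simp [hu]
    · rw [intervalIntegrable_iff]
      exact ((intervalIntegrable_iff.1 (intervalIntegrable_const (μ := MeasureTheory.volume)
        (c := (1 : ℂ)))).indicator measurableSet_Iic)
  | succ k ih =>
    intro s hs
    have h1 := (hd s).const_mul (x ^ k)
    rw [← mul_assoc, ← pow_succ] at h1
    refine mem_of_hasDerivAt M hM ?_ h1
    filter_upwards [isOpen_Ioo.mem_nhds hs] with t ht using ih t ht

theorem hasStrictDerivAt_of_exp_eq {G : Set ℂ} (hG : IsOpen G) {L : ℂ → ℂ}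
    (hL : ContinuousOn L G) (hexp : ∀ z ∈ G, Complex.exp (L z) = z) {z : ℂ} (hz : z ∈ G) :
    HasStrictDerivAt L z⁻¹ z := by
  have h1 := Complex.hasStrictDerivAt_exp (L z)
  rw [hexp z hz] at h1
  refine h1.of_local_left_inverse (hL.continuousAt (hG.mem_nhds hz)) ?_ ?_
  · rw [← hexp z hz]
    exact Complex.exp_ne_zero _
  · filter_upwards [hG.mem_nhds hz] with w hw using hexp w hw

theorem isOpen_image_of_exp_eq {G : Set ℂ} (hG : IsOpen G) {L : ℂ → ℂ}
    (hL : ContinuousOn L G) (hexp : ∀ z ∈ G, Complex.exp (L z) = z) : IsOpen (L '' G) := by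
  rw [isOpen_iff_mem_nhds]
  rintro _ ⟨z, hz, rfl⟩
  have hz0 : z ≠ 0 := by
    rw [← hexp z hz]
    exact Complex.exp_ne_zero _
  rw [← (hasStrictDerivAt_of_exp_eq hG hL hexp hz).map_nhds_eq (inv_ne_zero hz0)]
  exact image_mem_map (hG.mem_nhds hz)

/-- Since `exp` inverts `L`, a logarithm of `L - a` on `G` transports to `L '' G`. This supplies the
hypothesis of Runge's theorem without discussing homotopies in `L '' G`. -/
theorem exists_log_sub_on_image {G : Set ℂ} (hG : IsOpen G) (hGs : IsSimplyConnected G)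
    {L : ℂ → ℂ} (hL : ContinuousOn L G) (hexp : ∀ z ∈ G, Complex.exp (L z) = z) {a : ℂ}
    (ha : a ∉ L '' G) :
    ∃ ℓ : ℂ → ℂ, ContinuousOn ℓ (L '' G) ∧ ∀ w ∈ L '' G, Complex.exp (ℓ w) = w - a := by
  obtain ⟨ℓ, hℓ, hℓe⟩ := Complex.exists_continuousOn_eqOn_exp_comp hGs hG
    (g := fun z => L z - a) (hL.sub continuousOn_const)
    (by rintro ⟨z, hz, h⟩; exact ha ⟨z, hz, sub_eq_zero.1 h⟩)
  refine ⟨fun w => ℓ (Complex.exp w), hℓ.comp Complex.continuous_exp.continuousOn ?_, ?_⟩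
  · rintro _ ⟨z, hz, rfl⟩
    rwa [hexp z hz]
  · rintro _ ⟨z, hz, rfl⟩
    have h := hℓe hz
    simp only [Function.comp_apply] at h
    simp only [hexp z hz, h]

/-- The superposition `∫₁² χ(s) e^{isL(z)} ds` of the powers `z^{is} = e^{isL(z)}`. -/
noncomputable def powInt (L : ℂ → ℂ) (χ : ℝ → ℂ) (z : ℂ) : ℂ :=
  ∫ s in (1 : ℝ)..2, χ s * Complex.exp (s * (Complex.I * L z))

theorem exp_apply {X : Type*} [TopologicalSpace X] [CompactSpace X] (x : C(X, ℂ)) (z : X) :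
    NormedSpace.exp x z = Complex.exp (x z) := by
  have h := NormedSpace.map_exp (ContinuousMap.evalAlgHom ℂ ℂ z)
    (ContinuousEvalConst.continuous_eval_const z) x
  rw [Complex.exp_eq_exp_ℂ]
  exact h

theorem intervalIntegrable_smul_exp {A : Type*} [NormedCommRing A] [NormedAlgebra ℂ A]
    [CompleteSpace A] (x : A) {χ : ℝ → ℂ} (hχ : IntervalIntegrable χ MeasureTheory.volume 1 2) :
    IntervalIntegrable (fun s : ℝ => χ s • NormedSpace.exp ((s : ℂ) • x))
      MeasureTheory.volume 1 2 :=
  hχ.smul_continuousOn (continuous_exp_ofReal_smul x).continuousOn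

/-- On a compact space, `powInt` is the evaluation of an integral in the algebra of continuous
functions. -/
theorem integral_smul_exp_apply {X : Type*} [TopologicalSpace X] [CompactSpace X] (x : C(X, ℂ))
    {χ : ℝ → ℂ} (hχ : IntervalIntegrable χ MeasureTheory.volume 1 2) (z : X) :
    (∫ s in (1 : ℝ)..2, χ s • NormedSpace.exp ((s : ℂ) • x)) z =
      ∫ s in (1 : ℝ)..2, χ s * Complex.exp (s * x z) := by
  have h := (ContinuousMap.evalCLM ℂ z : C(X, ℂ) →L[ℂ] ℂ).intervalIntegral_comp_comm
    (intervalIntegrable_smul_exp x hχ)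
  refine Eq.trans h.symm ?_
  congr 1
  funext s
  change χ s * NormedSpace.exp ((s : ℂ) • x) z = _
  rw [exp_apply]
  rfl

theorem exists_powInt_norm_sub_lt {G : Set ℂ} (hG : IsOpen G) (hGs : IsSimplyConnected G)
    {L : ℂ → ℂ} (hL : ContinuousOn L G) (hexp : ∀ z ∈ G, Complex.exp (L z) = z) {K : Set ℂ}
    (hK : IsCompact K) (hKG : K ⊆ G) {f : ℂ → ℂ} (hf : DifferentiableOn ℂ f G) {ε : ℝ}
    (hε : 0 < ε) :
    ∃ χ : ℝ → ℂ, IntervalIntegrable χ MeasureTheory.volume 1 2 ∧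
      ∀ z ∈ K, ‖f z - powInt L χ z‖ < ε := by
  have : CompactSpace K := isCompact_iff_compactSpace.1 hK
  let y : C(K, ℂ) := ⟨fun z => L z, (hL.mono hKG).domRestrict⟩
  let x : C(K, ℂ) := Complex.I • y
  let F : C(K, ℂ) := ⟨fun z => f z, (hf.continuousOn.mono hKG).domRestrict⟩
  let N : Submodule ℂ C(K, ℂ) :=
    { carrier := {u | ∃ χ : ℝ → ℂ, IntervalIntegrable χ MeasureTheory.volume 1 2 ∧
        u = ∫ s in (1 : ℝ)..2, χ s • NormedSpace.exp ((s : ℂ) • x)}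
      add_mem' := by
        rintro _ _ ⟨χ, hχ, rfl⟩ ⟨χ', hχ', rfl⟩
        refine ⟨χ + χ', hχ.add hχ', ?_⟩
        rw [← intervalIntegral.integral_add (intervalIntegrable_smul_exp x hχ)
          (intervalIntegrable_smul_exp x hχ')]
        simp [add_smul]
      zero_mem' := ⟨0, intervalIntegrable_const, by simp⟩
      smul_mem' := by
        rintro c _ ⟨χ, hχ, rfl⟩
        refine ⟨c • χ, hχ.smul c, ?_⟩
        rw [← intervalIntegral.integral_smul]
        simp [smul_smul] }
  let M := N.topologicalClosure
  have hM : IsClosed (M : Set C(K, ℂ)) := N.isClosed_topologicalClosure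
  have hpow := pow_mul_exp_mem M hM x
    (fun χ hχ => N.le_topologicalClosure ⟨χ, hχ, rfl⟩)
  -- Any exponent inside `(1, 2)` would do.
  let E : C(K, ℂ) := NormedSpace.exp (((3 / 2 : ℝ) : ℂ) • x)
  have hpoly : ∀ p : Polynomial ℂ, Polynomial.aeval y p * E ∈ M := by
    intro p
    induction p using Polynomial.induction_on' with
    | add p q hp hq => rw [map_add, add_mul]; exact M.add_mem hp hq
    | monomial k c =>
      have hyx : y = (-Complex.I) • x := by simp [x, smul_smul]
      rw [Polynomial.aeval_monomial, hyx, smul_pow, mul_smul_comm, smul_mul_assoc, mul_assoc,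
        Algebra.algebraMap_eq_smul_one, smul_mul_assoc, one_mul]
      exact M.smul_mem _ (M.smul_mem _ (hpow k (3 / 2) (by norm_num)))
  have hFM : F ∈ M := by
    rw [← SetLike.mem_coe, ← hM.closure_eq, Metric.mem_closure_iff]
    intro δ hδ
    have hEn : 0 < ‖E‖ + 1 := by positivity
    -- Change variable to `w = L z` and divide by the zero-free factor `E`: it is `f / E` that is
    -- approximated by a polynomial in `L`, with tolerance small enough to survive multiplication by
    -- `E`.
    obtain ⟨p, hp⟩ := exists_polynomial_norm_sub_lt
      (hK.image_of_continuousOn (hL.mono hKG)) (isOpen_image_of_exp_eq hG hL hexp)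
      (Set.image_mono hKG) (fun a ha => exists_log_sub_on_image hG hGs hL hexp ha)
      (f := fun w => f (Complex.exp w) * Complex.exp (-((3 / 2 : ℝ) * (Complex.I * w)))) (by
        refine DifferentiableOn.mul ?_ (by fun_prop)
        refine hf.comp Complex.differentiable_exp.differentiableOn ?_
        rintro _ ⟨z, hz, rfl⟩
        rwa [hexp z hz])
      (div_pos hδ hEn)
    refine ⟨_, hpoly p, ?_⟩
    rw [ContinuousMap.dist_lt_iff hδ]
    intro z
    have h1 := hp (L z) ⟨z, z.2, rfl⟩
    rw [hexp z (hKG z.2)] at h1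
    have h2 : (Polynomial.aeval y p : C(K, ℂ)) z = p.eval (L z) := aeval_apply y p z
    have h3 : E z = Complex.exp ((3 / 2 : ℝ) * (Complex.I * L z)) := exp_apply _ _
    have h4 : F z - (Polynomial.aeval y p * E) z =
        (f z * Complex.exp (-((3 / 2 : ℝ) * (Complex.I * L z))) - p.eval (L z)) * E z := by
      rw [ContinuousMap.mul_apply, h2, sub_mul, mul_assoc, h3, ← Complex.exp_add, neg_add_cancel,
        Complex.exp_zero, mul_one]
      rfl
    rw [dist_eq_norm, h4, norm_mul]
    calc _ ≤ ‖f z * Complex.exp (-((3 / 2 : ℝ) * (Complex.I * L z))) - p.eval (L z)‖ * ‖E‖ := by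
          gcongr
          exact E.norm_coe_le_norm z
      _ ≤ δ / (‖E‖ + 1) * ‖E‖ := by gcongr
      _ < δ / (‖E‖ + 1) * (‖E‖ + 1) := by
          have := div_pos hδ hEn
          gcongr
          linarith
      _ = δ := div_mul_cancel₀ _ hEn.ne'
  obtain ⟨_, ⟨χ, hχ, rfl⟩, hd⟩ := Metric.mem_closure_iff.1 (show F ∈ closure _ from hFM) ε hε
  refine ⟨χ, hχ, fun z hz => ?_⟩
  have h1 := (ContinuousMap.dist_lt_iff hε).1 hd ⟨z, hz⟩
  rw [dist_eq_norm, integral_smul_exp_apply x hχ] at h1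
  exact h1

/-! ### Diagonal action of the operators on superpositions -/

open MeasureTheory in
theorem hasDerivAt_integral_exp {χ : ℝ → ℂ} (hχ : IntervalIntegrable χ volume 1 2) (w : ℂ) :
    HasDerivAt (fun w : ℂ => ∫ s in (1 : ℝ)..2, χ s * Complex.exp (s * (Complex.I * w)))
      (∫ s in (1 : ℝ)..2, s * Complex.I * χ s * Complex.exp (s * (Complex.I * w))) w := by
  have hm : ∀ c : ℝ → ℂ, Continuous c → ∀ w : ℂ,
      AEStronglyMeasurable (fun s : ℝ => c s * χ s * Complex.exp (s * (Complex.I * w)))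
        (volume.restrict (Set.uIoc 1 2)) := fun c hc w =>
    (hc.aestronglyMeasurable.mul hχ.aestronglyMeasurable_restrict_uIoc).mul
      (by fun_prop : Continuous fun s : ℝ => Complex.exp (s * (Complex.I * w))).aestronglyMeasurable
  refine (intervalIntegral.hasDerivAt_integral_of_dominated_loc_of_deriv_le
    (bound := fun s => 2 * Real.exp (2 * (‖w‖ + 1)) * ‖χ s‖)
    (F := fun w s => χ s * Complex.exp (s * (Complex.I * w)))
    (F' := fun w s => s * Complex.I * χ s * Complex.exp (s * (Complex.I * w)))
    (Metric.ball_mem_nhds w one_pos) ?_ ?_ ?_ ?_ ?_ ?_).2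
  · refine Eventually.of_forall fun w => ?_
    simpa using hm (fun _ => 1) continuous_const w
  · exact hχ.mul_continuousOn (by fun_prop)
  · exact hm (fun s => s * Complex.I) (by fun_prop) w
  · refine Eventually.of_forall fun s hs u hu => ?_
    rw [Set.uIoc_of_le one_le_two] at hs
    have hs0 : 0 ≤ s := by linarith [hs.1]
    have hun : ‖u‖ ≤ ‖w‖ + 1 := by
      have h1 : ‖u - w‖ < 1 := by simpa [dist_eq_norm] using hu
      linarith [norm_le_norm_add_norm_sub' u w]
    have h1 : ‖Complex.exp (s * (Complex.I * u))‖ ≤ Real.exp (2 * (‖w‖ + 1)) := by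
      refine (Complex.norm_exp_le_exp_norm _).trans (Real.exp_le_exp.2 ?_)
      simp only [norm_mul, Complex.norm_real, Complex.norm_I, one_mul, Real.norm_eq_abs,
        abs_of_nonneg hs0]
      gcongr
      exact hs.2
    have h2 : ‖(s : ℂ)‖ ≤ 2 := by
      rw [Complex.norm_real, Real.norm_eq_abs, abs_of_nonneg hs0]
      exact hs.2
    calc ‖(s : ℂ) * Complex.I * χ s * Complex.exp (s * (Complex.I * u))‖
        = ‖(s : ℂ)‖ * ‖Complex.exp (s * (Complex.I * u))‖ * ‖χ s‖ := by
          simp only [norm_mul, Complex.norm_I]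
          ring
      _ ≤ _ := by gcongr
  · exact hχ.norm.const_mul _
  · refine Eventually.of_forall fun s _ u _ => ?_
    have h1 : HasDerivAt (fun u : ℂ => (s : ℂ) * (Complex.I * u)) (s * (Complex.I * 1)) u :=
      ((hasDerivAt_id u).const_mul _).const_mul _
    convert! h1.cexp.const_mul (χ s) using 1
    ring

theorem IntervalIntegrable.continuous_mul {χ c : ℝ → ℂ}
    (hχ : IntervalIntegrable χ MeasureTheory.volume 1 2) (hc : Continuous c) :
    IntervalIntegrable (fun s => c s * χ s) MeasureTheory.volume 1 2 :=
  hχ.continuousOn_mul hc.continuousOn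

section

variable {G : Set ℂ} {L : ℂ → ℂ} {χ : ℝ → ℂ}

theorem hasDerivAt_powInt (hG : IsOpen G) (hL : ContinuousOn L G)
    (hexp : ∀ z ∈ G, Complex.exp (L z) = z)
    (hχ : IntervalIntegrable χ MeasureTheory.volume 1 2) {z : ℂ} (hz : z ∈ G) :
    HasDerivAt (powInt L χ) (z⁻¹ * powInt L (fun s => s * Complex.I * χ s) z) z := by
  have h := (hasDerivAt_integral_exp hχ (L z)).comp z
    (hasStrictDerivAt_of_exp_eq hG hL hexp hz).hasDerivAt
  rw [mul_comm]
  exact h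

theorem differentiableOn_powInt (hG : IsOpen G) (hL : ContinuousOn L G)
    (hexp : ∀ z ∈ G, Complex.exp (L z) = z)
    (hχ : IntervalIntegrable χ MeasureTheory.volume 1 2) : DifferentiableOn ℂ (powInt L χ) G :=
  fun _ hz => (hasDerivAt_powInt hG hL hexp hχ hz).differentiableAt.differentiableWithinAt

theorem continuous_prod_sub (j : ℕ) :
    Continuous fun s : ℝ => ∏ i ∈ Finset.range j, ((s : ℂ) * Complex.I - i) := by
  fun_prop

theorem powInt_add {χ' : ℝ → ℂ} (hχ : IntervalIntegrable χ MeasureTheory.volume 1 2)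
    (hχ' : IntervalIntegrable χ' MeasureTheory.volume 1 2) (z : ℂ) :
    powInt L (fun s => χ s + χ' s) z = powInt L χ z + powInt L χ' z := by
  unfold powInt
  rw [← intervalIntegral.integral_add (hχ.mul_continuousOn (by fun_prop))
    (hχ'.mul_continuousOn (by fun_prop))]
  simp only [add_mul]

theorem powInt_const_mul (c : ℂ) (z : ℂ) :
    powInt L (fun s => c * χ s) z = c * powInt L χ z := by
  unfold powInt
  rw [← intervalIntegral.integral_const_mul]
  simp only [mul_assoc]

theorem iteratedDeriv_powInt (hG : IsOpen G) (hL : ContinuousOn L G)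
    (hexp : ∀ z ∈ G, Complex.exp (L z) = z)
    (hχ : IntervalIntegrable χ MeasureTheory.volume 1 2) (j : ℕ) {z : ℂ} (hz : z ∈ G) :
    iteratedDeriv j (powInt L χ) z =
      (z ^ j)⁻¹ * powInt L (fun s => (∏ i ∈ Finset.range j, (s * Complex.I - i)) * χ s) z := by
  induction j generalizing z with
  | zero => simp
  | succ j ih =>
    have hz0 : z ≠ 0 := by
      rw [← hexp z hz]
      exact Complex.exp_ne_zero _
    have hi := hχ.continuous_mul (continuous_prod_sub j)
    have h1 : iteratedDeriv j (powInt L χ) =ᶠ[𝓝 z] fun z => (z ^ j)⁻¹ *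
        powInt L (fun s => (∏ i ∈ Finset.range j, (s * Complex.I - i)) * χ s) z := by
      filter_upwards [hG.mem_nhds hz] with w hw using ih hw
    have h2 : HasDerivAt (fun z : ℂ => (z ^ j)⁻¹) (-(j * z ^ (j - 1)) / (z ^ j) ^ 2) z :=
      (hasDerivAt_pow j z).fun_inv (pow_ne_zero j hz0)
    rw [iteratedDeriv_succ, h1.deriv_eq, (h2.fun_mul (hasDerivAt_powInt hG hL hexp hi hz)).deriv]
    have h3 : (fun s : ℝ => (∏ i ∈ Finset.range (j + 1), ((s : ℂ) * Complex.I - i)) * χ s) =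
        fun s : ℝ => s * Complex.I * ((∏ i ∈ Finset.range j, ((s : ℂ) * Complex.I - i)) * χ s) +
          -(j : ℂ) * ((∏ i ∈ Finset.range j, ((s : ℂ) * Complex.I - i)) * χ s) := by
      funext s
      rw [Finset.prod_range_succ]
      ring
    rw [h3, powInt_add (hi.continuous_mul (by fun_prop)) (hi.const_mul _), powInt_const_mul]
    -- The derivative of `z ^ j` carries the truncated exponent `j - 1`, so `j = 0` is separate.
    rcases j with _ | j
    · simp
    · have : z ^ (j + 1) ≠ 0 := pow_ne_zero _ hz0
      have : z ^ (j + 1 + 1) ≠ 0 := pow_ne_zero _ hz0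
      rw [Nat.add_sub_cancel]
      generalize powInt L _ z = P
      generalize powInt L _ z = Q
      field_simp
      ring

/-- The eigenvalue of `T̃ₙ` at the eigenfunction `z ^ β`. -/
noncomputable def taylorEigenvalue (n : ℕ) (β : ℂ) : ℂ :=
  ∏ j ∈ Finset.range n, (1 - β / (j + 1))

/-- This is `∑_{j≤n} (-1)^j C(β, j) = ∏_{j=1}^{n} (1 - β/j)`. The term of index `n + 1` is
`-β/(n+1)` times the product up to `n`, which makes the induction close. -/
theorem sum_prod_sub_eq_taylorEigenvalue (n : ℕ) (β : ℂ) :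
    ∑ j ∈ Finset.range (n + 1), (-1) ^ j / (j.factorial : ℂ) * ∏ i ∈ Finset.range j, (β - i) =
      taylorEigenvalue n β := by
  have key : ∀ n : ℕ, (-1) ^ (n + 1) / ((n + 1).factorial : ℂ) *
      ∏ i ∈ Finset.range (n + 1), (β - i) = -(β / (n + 1)) * taylorEigenvalue n β := by
    intro n
    induction n with
    | zero => simp [taylorEigenvalue]
    | succ n ih =>
      have h1 : ((n : ℂ) + 1) ≠ 0 := by exact_mod_cast n.succ_ne_zero
      have h2 : ((n : ℂ) + 1 + 1) ≠ 0 := by exact_mod_cast (n + 1).succ_ne_zero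
      have h3 : ((n + 1).factorial : ℂ) ≠ 0 := by exact_mod_cast (n + 1).factorial_ne_zero
      have h5 : taylorEigenvalue (n + 1) β = taylorEigenvalue n β * (1 - β / (n + 1)) :=
        Finset.prod_range_succ _ _
      have h4 : (-1) ^ (n + 1 + 1) / (((n + 1 + 1) * (n + 1).factorial : ℕ) : ℂ) *
          ((∏ i ∈ Finset.range (n + 1), (β - i)) * (β - (n + 1 : ℕ))) =
          -(β - (n + 1)) / (n + 1 + 1) * ((-1) ^ (n + 1) / ((n + 1).factorial : ℂ) *
            ∏ i ∈ Finset.range (n + 1), (β - i)) := by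
        push_cast
        field_simp
        ring
      rw [Finset.prod_range_succ _ (n + 1), Nat.factorial_succ (n + 1), h4, ih, h5]
      push_cast
      field_simp
      ring
  induction n with
  | zero => simp [taylorEigenvalue]
  | succ n ih =>
    rw [Finset.sum_range_succ, ih, key, taylorEigenvalue, taylorEigenvalue, Finset.prod_range_succ]
    ring

theorem continuous_taylorEigenvalue (n : ℕ) :
    Continuous fun s : ℝ => taylorEigenvalue n (s * Complex.I) := by
  unfold taylorEigenvalue
  fun_prop

/-- In each term the factor `z^{-j}` from the `j`-th derivative cancels `(-z)^j` up to sign, so only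
the weight changes. -/
theorem taylorAtZero_powInt (hG : IsOpen G) (hL : ContinuousOn L G)
    (hexp : ∀ z ∈ G, Complex.exp (L z) = z)
    (hχ : IntervalIntegrable χ MeasureTheory.volume 1 2) (n : ℕ) {z : ℂ} (hz : z ∈ G) :
    taylorAtZero n (powInt L χ) z =
      powInt L (fun s => taylorEigenvalue n (s * Complex.I) * χ s) z := by
  have hz0 : z ≠ 0 := by
    rw [← hexp z hz]
    exact Complex.exp_ne_zero _
  have h1 : ∀ j, iteratedDeriv j (powInt L χ) z / (j.factorial : ℂ) * (-z) ^ j =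
      powInt L (fun s => (-1) ^ j / (j.factorial : ℂ) *
        ((∏ i ∈ Finset.range j, (s * Complex.I - i)) * χ s)) z := by
    intro j
    have : z ^ j ≠ 0 := pow_ne_zero _ hz0
    rw [iteratedDeriv_powInt hG hL hexp hχ j hz, powInt_const_mul, neg_pow]
    generalize powInt L _ z = P
    field_simp
  unfold taylorAtZero
  rw [Finset.sum_congr rfl fun j _ => h1 j]
  unfold powInt
  rw [← intervalIntegral.integral_finsetSum]
  · congr 1
    funext s
    beta_reduce
    rw [← sum_prod_sub_eq_taylorEigenvalue, Finset.sum_mul, Finset.sum_mul]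
    refine Finset.sum_congr rfl fun j _ => ?_
    ring
  · intro j _
    exact (((hχ.continuous_mul (continuous_prod_sub j)).const_mul _).mul_continuousOn
      (by fun_prop))

end

/-! ### Convergence of superpositions from convergence of weights -/

section

variable {G K : Set ℂ} {L : ℂ → ℂ} {χ : ℝ → ℂ}

theorem exists_norm_powInt_le (hK : IsCompact K) (hL : ContinuousOn L K) :
    ∃ C : ℝ, 0 < C ∧ ∀ χ : ℝ → ℂ, IntervalIntegrable χ MeasureTheory.volume 1 2 → ∀ z ∈ K,
      ‖powInt L χ z‖ ≤ C * ∫ s in (1 : ℝ)..2, ‖χ s‖ := by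
  obtain ⟨B, hB⟩ := hK.exists_bound_of_continuousOn hL
  refine ⟨Real.exp (2 * B), Real.exp_pos _, fun χ hχ z hz => ?_⟩
  rw [← intervalIntegral.integral_const_mul]
  refine intervalIntegral.norm_integral_le_of_norm_le one_le_two ?_ (hχ.norm.const_mul _)
  refine Eventually.of_forall fun s hs => ?_
  have hs0 : 0 ≤ s := by linarith [hs.1]
  rw [norm_mul, mul_comm]
  gcongr
  refine (Complex.norm_exp_le_exp_norm _).trans (Real.exp_le_exp.2 ?_)
  simp only [norm_mul, Complex.norm_real, Complex.norm_I, one_mul, Real.norm_eq_abs,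
    abs_of_nonneg hs0]
  have := hB z hz
  gcongr
  exact hs.2

theorem tendstoUniformlyOn_powInt_zero {ι : Type*} {l : Filter ι} (hK : IsCompact K)
    (hL : ContinuousOn L K) {χ : ι → ℝ → ℂ}
    (hχ : ∀ i, IntervalIntegrable (χ i) MeasureTheory.volume 1 2)
    (h : Tendsto (fun i => ∫ s in (1 : ℝ)..2, ‖χ i s‖) l (𝓝 0)) :
    TendstoUniformlyOn (fun i => powInt L (χ i)) 0 l K := by
  obtain ⟨C, hC, hb⟩ := exists_norm_powInt_le hK hL
  rw [Metric.tendstoUniformlyOn_iff]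
  intro ε hε
  have h1 := h.const_mul C
  rw [mul_zero] at h1
  filter_upwards [h1.eventually_lt_const hε] with i hi z hz
  rw [Pi.zero_apply, dist_zero_left]
  exact (hb _ (hχ i) z hz).trans_lt hi

/-- The Riemann–Lebesgue lemma for `powInt`, uniformly on compact sets. -/
theorem tendstoUniformlyOn_powInt_riemannLebesgue {ι : Type*} {l : Filter ι} (hK : IsCompact K)
    (hL : ContinuousOn L K) (hχ : IntervalIntegrable χ MeasureTheory.volume 1 2) {t : ι → ℝ}
    (ht : Tendsto (fun i => |t i|) l atTop) :
    TendstoUniformlyOn (fun i => powInt L fun s => Complex.exp (s * Complex.I * t i) * χ s) 0 l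
      K := by
  have : CompactSpace K := isCompact_iff_compactSpace.1 hK
  let x : C(K, ℂ) := Complex.I • ⟨fun z => L z, hL.domRestrict⟩
  -- Riemann–Lebesgue is applied to a function with values in `C(K, ℂ)`, so that the decay is
  -- uniform in `z ∈ K`. The frequency `-t / 2π` matches the normalization of `Real.fourierChar`.
  let u : ℝ → C(K, ℂ) := fun s => χ s • NormedSpace.exp ((s : ℂ) • x)
  have hcoc : Tendsto (fun i => -(t i) / (2 * Real.pi)) l (cocompact ℝ) := by
    rw [← Metric.cobounded_eq_cocompact, ← tendsto_norm_atTop_iff_cobounded]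
    have h1 := ht.atTop_div_const (r := 2 * Real.pi) (by positivity)
    refine h1.congr fun i => ?_
    rw [Real.norm_eq_abs, abs_div, abs_neg, abs_of_pos Real.two_pi_pos]
  have h := (Real.tendsto_integral_exp_smul_cocompact ((Set.Ioc 1 2).indicator u)).comp hcoc
  rw [Metric.tendstoUniformlyOn_iff]
  intro ε hε
  have h1 := h.norm
  rw [norm_zero] at h1
  filter_upwards [h1.eventually_lt_const hε] with i hi z hz
  rw [Pi.zero_apply, dist_zero_left]
  have hχ' : IntervalIntegrable (fun s => Complex.exp (s * Complex.I * t i) * χ s)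
      MeasureTheory.volume 1 2 := hχ.continuous_mul (by fun_prop)
  have h2 := integral_smul_exp_apply x hχ' ⟨z, hz⟩
  have h3 : (∫ s in (1 : ℝ)..2, (Complex.exp (s * Complex.I * t i) * χ s) •
        NormedSpace.exp ((s : ℂ) • x)) =
      ∫ v : ℝ, Real.fourierChar (-(v * (-(t i) / (2 * Real.pi)))) •
        (Set.Ioc 1 2).indicator u v := by
    rw [intervalIntegral.integral_of_le one_le_two,
      ← MeasureTheory.integral_indicator measurableSet_Ioc]
    congr 1
    funext v
    by_cases hv : v ∈ Set.Ioc 1 2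
    · rw [Set.indicator_of_mem hv, Set.indicator_of_mem hv, Circle.smul_def,
        Real.fourierChar_apply, mul_smul]
      congr 2
      have : (Real.pi : ℂ) ≠ 0 := by simp [Real.pi_ne_zero]
      push_cast
      field_simp
    · rw [Set.indicator_of_notMem hv, Set.indicator_of_notMem hv, smul_zero]
  rw [h3] at h2
  refine lt_of_le_of_lt ?_ hi
  refine le_trans (le_of_eq ?_) (ContinuousMap.norm_coe_le_norm _ ⟨z, hz⟩)
  exact congrArg norm h2.symm

theorem tendsto_integral_norm_mul {m : ℕ → ℝ → ℂ} {m' : ℝ → ℂ}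
    (hχ : IntervalIntegrable χ MeasureTheory.volume 1 2) (hm : ∀ n, Continuous (m n))
    (hm' : Continuous m') {C : ℝ} (hC : ∀ n, ∀ s ∈ Set.Ioc (1 : ℝ) 2, ‖m n s‖ ≤ C)
    (hlim : ∀ s ∈ Set.Ioc (1 : ℝ) 2, Tendsto (fun n => m n s) atTop (𝓝 (m' s))) :
    Tendsto (fun n => ∫ s in (1 : ℝ)..2, ‖(m n s - m' s) * χ s‖) atTop (𝓝 0) := by
  have hC' : ∀ s ∈ Set.Ioc (1 : ℝ) 2, ‖m' s‖ ≤ C := fun s hs =>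
    le_of_tendsto (hlim s hs).norm (Eventually.of_forall fun n => hC n s hs)
  have h0 : (0 : ℝ) = ∫ s in (1 : ℝ)..2, (0 : ℝ) := by simp
  rw [h0]
  refine intervalIntegral.tendsto_integral_filter_of_dominated_convergence
    (fun s => (C + C) * ‖χ s‖) ?_ ?_ (hχ.norm.const_mul _) ?_
  · refine Eventually.of_forall fun n => ?_
    exact (((hm n).sub hm').aestronglyMeasurable.mul hχ.aestronglyMeasurable_restrict_uIoc).norm
  · refine Eventually.of_forall fun n => Eventually.of_forall fun s hs => ?_
    rw [Set.uIoc_of_le one_le_two] at hs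
    rw [norm_norm, norm_mul]
    gcongr
    exact (norm_sub_le _ _).trans (add_le_add (hC n s hs) (hC' s hs))
  · refine Eventually.of_forall fun s hs => ?_
    rw [Set.uIoc_of_le one_le_two] at hs
    have h1 := (((hlim s hs).sub_const (m' s)).mul_const (χ s)).norm
    simpa using h1

theorem tendstoUniformlyOn_powInt_mul {m : ℕ → ℝ → ℂ} {m' : ℝ → ℂ} (hK : IsCompact K)
    (hL : ContinuousOn L K) (hχ : IntervalIntegrable χ MeasureTheory.volume 1 2)
    (hm : ∀ n, Continuous (m n)) (hm' : Continuous m') {C : ℝ}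
    (hC : ∀ n, ∀ s ∈ Set.Ioc (1 : ℝ) 2, ‖m n s‖ ≤ C)
    (hlim : ∀ s ∈ Set.Ioc (1 : ℝ) 2, Tendsto (fun n => m n s) atTop (𝓝 (m' s))) :
    TendstoUniformlyOn (fun n => powInt L fun s => m n s * χ s) (powInt L fun s => m' s * χ s)
      atTop K := by
  have hi : ∀ n, IntervalIntegrable (fun s => (m n s - m' s) * χ s) MeasureTheory.volume 1 2 :=
    fun n => hχ.continuous_mul ((hm n).sub hm')
  have h1 := tendstoUniformlyOn_powInt_zero hK hL hi (tendsto_integral_norm_mul hχ hm hm' hC hlim)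
  rw [Metric.tendstoUniformlyOn_iff] at h1 ⊢
  intro ε hε
  filter_upwards [h1 ε hε] with n hn z hz
  have h2 : (fun s => m n s * χ s) = fun s => (m n s - m' s) * χ s + m' s * χ s := by
    funext s
    ring
  have h3 := hn z hz
  rw [Pi.zero_apply, dist_zero_left] at h3
  rw [h2, powInt_add (hi n) (hχ.continuous_mul hm'),
    dist_comm, dist_eq_norm]
  simpa using h3

/-- The phase is unimodular, so replacing `m n` by its limit `m'` costs an error small in `L¹`;
Riemann–Lebesgue handles the fixed weight `m' χ`. -/
theorem tendstoUniformlyOn_powInt_exp_mul {m : ℕ → ℝ → ℂ} {m' : ℝ → ℂ} (hK : IsCompact K)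
    (hL : ContinuousOn L K) (hχ : IntervalIntegrable χ MeasureTheory.volume 1 2)
    (hm : ∀ n, Continuous (m n)) (hm' : Continuous m') {C : ℝ}
    (hC : ∀ n, ∀ s ∈ Set.Ioc (1 : ℝ) 2, ‖m n s‖ ≤ C)
    (hlim : ∀ s ∈ Set.Ioc (1 : ℝ) 2, Tendsto (fun n => m n s) atTop (𝓝 (m' s))) {t : ℕ → ℝ}
    (ht : Tendsto (fun i => |t i|) atTop atTop) :
    TendstoUniformlyOn
      (fun n => powInt L fun s => Complex.exp (s * Complex.I * t n) * (m n s * χ s)) 0 atTop K := by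
  have hi : ∀ n, IntervalIntegrable
      (fun s => Complex.exp (s * Complex.I * t n) * ((m n s - m' s) * χ s))
      MeasureTheory.volume 1 2 := fun n =>
    (hχ.continuous_mul ((hm n).sub hm')).continuous_mul (by fun_prop)
  have hlim' : Tendsto (fun n => ∫ s in (1 : ℝ)..2,
      ‖Complex.exp (s * Complex.I * t n) * ((m n s - m' s) * χ s)‖) atTop (𝓝 0) := by
    refine (tendsto_integral_norm_mul hχ hm hm' hC hlim).congr fun n => ?_
    congr 1
    funext s
    have : (s : ℂ) * Complex.I * t n = ((s * t n : ℝ) : ℂ) * Complex.I := by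
      push_cast
      ring
    rw [norm_mul (Complex.exp _), this, Complex.norm_exp_ofReal_mul_I, one_mul]
  have h1 := tendstoUniformlyOn_powInt_zero hK hL hi hlim'
  have h2 := tendstoUniformlyOn_powInt_riemannLebesgue hK hL (hχ.continuous_mul hm') ht
  rw [Metric.tendstoUniformlyOn_iff] at h1 h2 ⊢
  intro ε hε
  filter_upwards [h1 (ε / 2) (half_pos hε), h2 (ε / 2) (half_pos hε)] with n hn hn' z hz
  have h3 : (fun s : ℝ => Complex.exp (s * Complex.I * t n) * (m n s * χ s)) = fun s : ℝ =>
      Complex.exp (s * Complex.I * t n) * ((m n s - m' s) * χ s) +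
        Complex.exp (s * Complex.I * t n) * (m' s * χ s) := by
    funext s
    ring
  have h4 := hn z hz
  have h5 := hn' z hz
  rw [Pi.zero_apply, dist_zero_left] at h4 h5 ⊢
  rw [h3, powInt_add (hi n) ((hχ.continuous_mul hm').continuous_mul (by fun_prop))]
  exact (norm_add_le _ _).trans_lt (by linarith)

end

/-! ### Size and asymptotics of the eigenvalues -/

theorem norm_one_sub_div_le (s : ℝ) (j : ℕ) : ‖1 - (s : ℂ) * Complex.I / (j + 1)‖ ≤
    Real.exp (s ^ 2 * (1 / ((j : ℝ) + 1) ^ 2) / 2) := by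
  have hj : (0 : ℝ) < j + 1 := by positivity
  have e : 1 - (s : ℂ) * Complex.I / (j + 1) =
      ((1 : ℝ) : ℂ) + ((-(s / (j + 1)) : ℝ) : ℂ) * Complex.I := by
    push_cast
    ring
  rw [e, Complex.norm_add_mul_I]
  refine Real.sqrt_le_iff.2 ⟨(Real.exp_pos _).le, ?_⟩
  rw [← Real.exp_nat_mul]
  have h2 := Real.add_one_le_exp (s ^ 2 * (1 / ((j : ℝ) + 1) ^ 2))
  calc (1 : ℝ) ^ 2 + (-(s / (j + 1))) ^ 2 = s ^ 2 * (1 / ((j : ℝ) + 1) ^ 2) + 1 := by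
        rw [neg_sq, div_pow]
        ring
    _ ≤ _ := h2
    _ = _ := by
        congr 1
        push_cast
        ring

/-- For purely imaginary `β = is` each factor has squared modulus `1 + s²/(j+1)²`, with no
first-order term, so the products are controlled by the convergent sum of `1/(j+1)²`. -/
theorem exists_norm_taylorEigenvalue_le :
    ∃ C : ℝ, ∀ n : ℕ, ∀ s ∈ Set.Ioc (1 : ℝ) 2, ‖taylorEigenvalue n (s * Complex.I)‖ ≤ C := by
  have hs : Summable fun j : ℕ => 1 / ((j : ℝ) + 1) ^ 2 := by
    have := (summable_nat_add_iff 1).2 (Real.summable_one_div_nat_pow.2 one_lt_two)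
    simpa using this
  refine ⟨Real.exp (2 * ∑' j : ℕ, 1 / ((j : ℝ) + 1) ^ 2), fun n s hs' => ?_⟩
  have hs2 : s ^ 2 ≤ 4 := by nlinarith [hs'.1, hs'.2]
  calc ‖taylorEigenvalue n (s * Complex.I)‖
      ≤ ∏ j ∈ Finset.range n, Real.exp (2 * (1 / ((j : ℝ) + 1) ^ 2)) := by
        rw [taylorEigenvalue, norm_prod]
        refine Finset.prod_le_prod (fun _ _ => norm_nonneg _) fun j _ => ?_
        refine (norm_one_sub_div_le s j).trans (Real.exp_le_exp.2 ?_)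
        have : 0 ≤ 1 / ((j : ℝ) + 1) ^ 2 := by positivity
        nlinarith
    _ = Real.exp (2 * ∑ j ∈ Finset.range n, 1 / ((j : ℝ) + 1) ^ 2) := by
        rw [← Real.exp_sum, Finset.mul_sum]
    _ ≤ _ := by
        gcongr
        exact hs.sum_le_tsum _ fun _ _ => by positivity

/-- With `β = is`, the sequence is eventually the reciprocal of `-β` times Euler's sequence for
`Γ(-β)`, and `-β Γ(-β) = Γ(1 - β)`. -/
theorem tendsto_taylorEigenvalue_mul_exp {s : ℝ} (hs : s ≠ 0) :
    Tendsto (fun n : ℕ => taylorEigenvalue n (s * Complex.I) *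
      Complex.exp (s * Complex.I * Real.log n)) atTop (𝓝 (Complex.Gamma (1 - s * Complex.I))⁻¹) := by
  set β : ℂ := s * Complex.I
  have hβ : β ≠ 0 := by simp [β, hs]
  have hΓ : Complex.Gamma (-β) ≠ 0 := by
    refine Complex.Gamma_ne_zero fun m hm => ?_
    have := congrArg Complex.im hm
    simp [β, hs] at this
  have h1 := ((Complex.GammaSeq_tendsto_Gamma (-β)).const_mul (-β)).inv₀
    (mul_ne_zero (neg_ne_zero.2 hβ) hΓ)
  rw [← Complex.Gamma_add_one _ (neg_ne_zero.2 hβ), neg_add_eq_sub] at h1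
  refine h1.congr' ?_
  filter_upwards [eventually_ne_atTop 0] with n hn
  have hn' : (n : ℂ) ≠ 0 := by exact_mod_cast hn
  have h2 : ∏ j ∈ Finset.range (n + 1), (-β + j) =
      -β * (n.factorial * taylorEigenvalue n β) := by
    rw [Finset.prod_range_succ', mul_comm, taylorEigenvalue, ← Finset.prod_range_add_one_eq_factorial]
    push_cast
    rw [← Finset.prod_mul_distrib, add_zero]
    congr 1
    refine Finset.prod_congr rfl fun j _ => ?_
    have : (j : ℂ) + 1 ≠ 0 := by exact_mod_cast j.succ_ne_zero
    field_simp
    ring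
  have h3 : Complex.exp (β * Real.log n) = (n : ℂ) ^ β := by
    rw [Complex.cpow_def_of_ne_zero hn', Complex.natCast_log, mul_comm]
  have h4 : (n.factorial : ℂ) ≠ 0 := by exact_mod_cast n.factorial_ne_zero
  have h5 : (n : ℂ) ^ β ≠ 0 := by
    rw [← h3]
    exact Complex.exp_ne_zero _
  rw [Complex.GammaSeq, h2, h3, Complex.cpow_neg]
  field_simp

theorem continuous_Gamma_one_sub : Continuous fun s : ℝ => Complex.Gamma (1 - s * Complex.I) := by
  refine continuous_iff_continuousAt.2 fun s => ?_
  refine ContinuousAt.comp (f := fun s : ℝ => 1 - (s : ℂ) * Complex.I)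
    (Complex.differentiableAt_Gamma _ fun m hm => ?_).continuousAt (by fun_prop)
  have := congrArg Complex.re hm
  simp at this
  have hm0 : (0 : ℝ) ≤ m := m.cast_nonneg
  linarith

theorem Gamma_one_sub_ne_zero (s : ℝ) : Complex.Gamma (1 - s * Complex.I) ≠ 0 :=
  Complex.Gamma_ne_zero_of_re_pos (by simp)

/-! ### Transitivity and the topology of `H(G)` -/

/-- Birkhoff's transitivity criterion. -/
theorem exists_dense_range_of_transitive {X Y : Type*} [TopologicalSpace X] [BaireSpace X]
    [Nonempty X] [TopologicalSpace Y] [SecondCountableTopology Y] (T : ℕ → X → Y)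
    (hT : ∀ n, Continuous (T n))
    (h : ∀ U : Set X, IsOpen U → U.Nonempty → ∀ V : Set Y, IsOpen V → V.Nonempty →
      ∃ n, ∃ x ∈ U, T n x ∈ V) : ∃ x, Dense (Set.range fun n => T n x) := by
  have hd : Dense (⋂ V ∈ countableBasis Y, ⋃ n, T n ⁻¹' V) := by
    refine dense_biInter_of_isOpen (fun V hV => ?_) (countable_countableBasis Y) fun V hV => ?_
    · exact isOpen_iUnion fun n => (isOpen_of_mem_countableBasis hV).preimage (hT n)
    · rw [dense_iff_inter_open]
      intro U hU hUne
      obtain ⟨n, x, hxU, hxV⟩ := h U hU hUne V (isOpen_of_mem_countableBasis hV)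
        (nonempty_of_mem_countableBasis hV)
      exact ⟨x, hxU, Set.mem_iUnion.2 ⟨n, hxV⟩⟩
  obtain ⟨x, hx⟩ := hd.nonempty
  refine ⟨x, (isBasis_countableBasis Y).dense_iff.2 fun V hV _ => ?_⟩
  obtain ⟨n, hn⟩ := Set.mem_iUnion.1 (Set.mem_iInter₂.1 hx V hV)
  exact ⟨T n x, hn, n, rfl⟩

theorem isClosed_holSpace (G : Opens ℂ) : IsClosed (HolSpace G : Set C(G, ℂ)) := by
  have : LocallyCompactSpace G := G.isOpen.locallyCompactSpace
  refine isClosed_of_closure_subset fun f hf => ?_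
  have hne := mem_closure_iff_nhdsWithin_neBot.1 hf
  have h1 : Tendsto (fun u : C(G, ℂ) => u) (𝓝[(HolSpace G : Set C(G, ℂ))] f) (𝓝 f) :=
    tendsto_id.mono_left nhdsWithin_le_nhds
  rw [ContinuousMap.tendsto_iff_tendstoLocallyUniformly] at h1
  have h2 : TendstoLocallyUniformlyOn (fun u : C(G, ℂ) => extendZero u) (extendZero f)
      (𝓝[(HolSpace G : Set C(G, ℂ))] f) (G : Set ℂ) := by
    rw [tendstoLocallyUniformlyOn_iff_tendstoLocallyUniformly_comp_coe]
    have h3 : ∀ u : C(G, ℂ), (fun z : G => extendZero u z) = u := fun u =>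
      funext fun z => extendZero_coe _ z
    have h4 : (fun (u : C(G, ℂ)) (z : G) => extendZero u z) = fun u z => u z := funext h3
    have h5 : extendZero f ∘ ((↑) : G → ℂ) = f := h3 f
    exact (by rw [← h5, ← h4] at h1; exact h1)
  exact h2.differentiableOn (eventually_mem_nhdsWithin.mono fun u hu => hu) G.isOpen

instance (G : Opens ℂ) : BaireSpace (HolSpace G) := by
  have : LocallyCompactSpace G := G.isOpen.locallyCompactSpace
  have : CompleteSpace (HolSpace G) := (isClosed_holSpace G).completeSpace_coe
  have : (uniformity (HolSpace G)).IsCountablyGenerated := by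
    rw [uniformity_subtype]
    infer_instance
  infer_instance

instance (G : Opens ℂ) : SecondCountableTopology (HolSpace G) := by
  have : LocallyCompactSpace G := G.isOpen.locallyCompactSpace
  exact Subtype.secondCountableTopology _

instance (G : Opens ℂ) : ContinuousAdd (HolSpace G) :=
  AddSubmonoid.continuousAdd (HolSpace G).toAddSubmonoid

theorem HolSpace.holFun_mk {G : Opens ℂ} (g : ℂ → ℂ) (hg : DifferentiableOn ℂ g G) {z : ℂ}
    (hz : z ∈ G) : holFun (HolSpace.mk g hg) z = g z :=
  extendZero_coe (fun w : G => g w) ⟨z, hz⟩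

theorem HolSpace.holFun_zero {G : Opens ℂ} : holFun (0 : HolSpace G) = 0 := by
  have := extendZero_smul (G := G) 0 0
  simpa [holFun] using this

theorem HolSpace.tendsto_mk {G : Opens ℂ} {ι : Type*} {l : Filter ι} {F : ι → ℂ → ℂ}
    (hF : ∀ i, DifferentiableOn ℂ (F i) G) {f : HolSpace G}
    (h : ∀ K : Set ℂ, IsCompact K → K ⊆ G → TendstoUniformlyOn F (holFun f) l K) :
    Tendsto (fun i => HolSpace.mk (F i) (hF i)) l (𝓝 f) := by
  rw [HolSpace.tendsto_iff, tendstoLocallyUniformlyOn_iff_forall_isCompact G.isOpen]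
  intro K hKG hK
  refine (h K hK hKG).congr (Eventually.of_forall fun i z hz => ?_)
  exact (HolSpace.holFun_mk _ _ (hKG hz)).symm

theorem HolSpace.dense_of_approx {G : Opens ℂ} {D : Set (HolSpace G)}
    (h : ∀ f : HolSpace G, ∀ K : Set ℂ, IsCompact K → K ⊆ G → ∀ ε > 0,
      ∃ g ∈ D, ∀ z ∈ K, ‖holFun f z - holFun g z‖ < ε) : Dense D := by
  intro f
  have hb := (nhds_basis_uniformity'
    (ContinuousMap.hasBasis_compactConvergenceUniformity (α := G) (β := ℂ))
    (x := (f : C(G, ℂ)))).comap ((↑) : HolSpace G → C(G, ℂ))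
  have hnhds : 𝓝 f = comap ((↑) : HolSpace G → C(G, ℂ)) (𝓝 (f : C(G, ℂ))) := nhds_induced _ _
  rw [← hnhds] at hb
  rw [mem_closure_iff_nhds_basis hb]
  rintro ⟨K, W⟩ ⟨hK, hW⟩
  obtain ⟨ε, hε, hεW⟩ := Metric.mem_uniformity_dist.1 hW
  obtain ⟨g, hgD, hg⟩ := h f ((↑) '' K) (hK.image continuous_subtype_val)
    (by rintro _ ⟨z, -, rfl⟩; exact z.2) ε hε
  refine ⟨g, hgD, fun z hz => hεW ?_⟩
  have := hg z ⟨z, hz, rfl⟩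
  rw [holFun, holFun, extendZero_coe, extendZero_coe] at this
  rwa [dist_eq_norm]

theorem tTilde_mk {G : Opens ℂ} {n : ℕ} {g g' : ℂ → ℂ} (hg : DifferentiableOn ℂ g G)
    (hg' : DifferentiableOn ℂ g' G) (h : ∀ z ∈ G, taylorAtZero n g z = g' z) :
    tTilde G n (HolSpace.mk g hg) = HolSpace.mk g' hg' := by
  apply Subtype.ext
  ext z
  rw [tTilde_mk_apply]
  exact h z z.2

/-! ### Separation of the frequencies `log λ_σ` and the universality theorem -/

theorem tendsto_log_sub_log_of_ratio {s : ℕ} {lam : Fin s → ℕ → ℕ} (hpos : ∀ σ n, 0 < lam σ n)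
    (hratio : ∀ (σ : ℕ) (hσ : σ + 1 < s),
      Tendsto (fun n => (lam ⟨σ + 1, hσ⟩ n : ℝ) / (lam ⟨σ, Nat.lt_of_succ_lt hσ⟩ n : ℝ))
        atTop atTop) {τ σ : Fin s} (h : τ < σ) :
    Tendsto (fun n => Real.log (lam σ n) - Real.log (lam τ n)) atTop atTop := by
  have hstep : ∀ (k : ℕ) (hk : k + 1 < s), Tendsto (fun n => Real.log (lam ⟨k + 1, hk⟩ n) -
      Real.log (lam ⟨k, Nat.lt_of_succ_lt hk⟩ n)) atTop atTop := by
    intro k hk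
    refine (Real.tendsto_log_atTop.comp (hratio k hk)).congr fun n => ?_
    exact Real.log_div (by exact_mod_cast (hpos _ n).ne') (by exact_mod_cast (hpos _ n).ne')
  obtain ⟨τ, hτ⟩ := τ
  obtain ⟨σ, hσ⟩ := σ
  have hτσ : τ + 1 ≤ σ := h
  clear h
  induction σ, hτσ using Nat.le_induction with
  | base => exact hstep τ hσ
  | succ k hk ih =>
    refine ((ih (Nat.lt_of_succ_lt hσ)).atTop_add_atTop (hstep k hσ)).congr fun n => ?_
    ring

theorem tendsto_atTop_of_ratio {s : ℕ} (hs : 0 < s) {lam : Fin s → ℕ → ℕ}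
    (hpos : ∀ σ n, 0 < lam σ n) (hlim : Tendsto (lam ⟨0, hs⟩) atTop atTop)
    (hratio : ∀ (σ : ℕ) (hσ : σ + 1 < s),
      Tendsto (fun n => (lam ⟨σ + 1, hσ⟩ n : ℝ) / (lam ⟨σ, Nat.lt_of_succ_lt hσ⟩ n : ℝ))
        atTop atTop) (σ : Fin s) : Tendsto (lam σ) atTop atTop := by
  rcases Nat.eq_zero_or_pos σ with h | h
  · rwa [show σ = ⟨0, hs⟩ from Fin.ext h]
  · have h1 := tendsto_log_sub_log_of_ratio hpos hratio (τ := ⟨0, hs⟩) (σ := σ) h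
    have h2 := h1.atTop_add_atTop
      (Real.tendsto_log_atTop.comp (tendsto_natCast_atTop_atTop.comp hlim))
    refine tendsto_natCast_atTop_iff.1 ((Real.tendsto_exp_atTop.comp h2).congr fun n => ?_)
    have : (0 : ℝ) < lam σ n := by exact_mod_cast hpos σ n
    simp [Real.exp_log this]

theorem theorem2p8 (G : Opens ℂ) (hG : IsSimplyConnected (G : Set ℂ)) (h0 : (0 : ℂ) ∉ G)
    (σ₀ : ℕ) (hσ₀ : 0 < σ₀) (lam : Fin σ₀ → ℕ → ℕ) (hpos : ∀ σ n, 0 < lam σ n)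
    (hlim : Tendsto (lam ⟨0, hσ₀⟩) atTop atTop)
    (hratio : ∀ (σ : ℕ) (hσ : σ + 1 < σ₀),
      Tendsto (fun n => (lam ⟨σ + 1, hσ⟩ n : ℝ) / (lam ⟨σ, Nat.lt_of_succ_lt hσ⟩ n : ℝ))
        atTop atTop) :
    IsUniversal (fun n => tTildeTuple G (fun σ => lam σ n)) := by
  obtain ⟨L, hL, hexp⟩ := Complex.exists_continuousOn_eqOn_exp_comp hG G.isOpen
    (g := fun z => z) continuousOn_id (by rintro ⟨z, hz, h⟩; exact h0 (h ▸ hz))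
  replace hexp : ∀ z ∈ (G : Set ℂ), Complex.exp (L z) = z := fun z hz => hexp hz
  have hdiff : ∀ {χ : ℝ → ℂ}, IntervalIntegrable χ MeasureTheory.volume 1 2 →
      DifferentiableOn ℂ (powInt L χ) G := fun hχ => differentiableOn_powInt G.isOpen hL hexp hχ
  let D : Set (HolSpace G) :=
    {f | ∃ (χ : ℝ → ℂ) (hχ : IntervalIntegrable χ MeasureTheory.volume 1 2),
      f = HolSpace.mk (powInt L χ) (hdiff hχ)}
  have hD : Dense D := by
    refine HolSpace.dense_of_approx fun f K hK hKG ε hε => ?_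
    obtain ⟨χ, hχ, happ⟩ := exists_powInt_norm_sub_lt G.isOpen hG hL hexp hK hKG
      (holFun_differentiableOn f) hε
    refine ⟨_, ⟨χ, hχ, rfl⟩, fun z hz => ?_⟩
    rw [HolSpace.holFun_mk _ _ (hKG hz)]
    exact happ z hz
  have hlam := tendsto_atTop_of_ratio hσ₀ hpos hlim hratio
  -- The eigenvalue with its oscillation `λ_τ^{-is}` removed: bounded and convergent to `m' = 1 /
  -- Γ(1 - is)`.
  let m : Fin σ₀ → ℕ → ℝ → ℂ := fun τ n s =>
    taylorEigenvalue (lam τ n) (s * Complex.I) * Complex.exp (s * Complex.I * Real.log (lam τ n))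
  let m' : ℝ → ℂ := fun s => (Complex.Gamma (1 - s * Complex.I))⁻¹
  have hm : ∀ τ n, Continuous (m τ n) := fun τ n =>
    (continuous_taylorEigenvalue (lam τ n)).mul (by fun_prop)
  have hm' : Continuous m' := continuous_Gamma_one_sub.inv₀ Gamma_one_sub_ne_zero
  obtain ⟨C, hC⟩ := exists_norm_taylorEigenvalue_le
  have hmC : ∀ τ n, ∀ s ∈ Set.Ioc (1 : ℝ) 2, ‖m τ n s‖ ≤ C := by
    intro τ n s hs
    have : (s : ℂ) * Complex.I * Real.log (lam τ n) =
        ((s * Real.log (lam τ n) : ℝ) : ℂ) * Complex.I := by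
      push_cast
      ring
    simp only [m, norm_mul (taylorEigenvalue _ _)]
    rw [this, Complex.norm_exp_ofReal_mul_I, mul_one]
    exact hC _ s hs
  have hmlim : ∀ τ, ∀ s ∈ Set.Ioc (1 : ℝ) 2,
      Tendsto (fun n => m τ n s) atTop (𝓝 (m' s)) := fun τ s hs =>
    (tendsto_taylorEigenvalue_mul_exp (by linarith [hs.1] : s ≠ 0)).comp (hlam τ)
  have hlog : ∀ τ, Tendsto (fun n => Real.log (lam τ n)) atTop atTop := fun τ =>
    Real.tendsto_log_atTop.comp (tendsto_natCast_atTop_atTop.comp (hlam τ))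
  refine exists_dense_range_of_transitive _ (fun n => (tTildeTuple G _).continuous) ?_
  intro U hU hUne V hV hVne
  obtain ⟨f, hfU, χ₀, hχ₀, rfl⟩ := hD.inter_open_nonempty U hU hUne
  obtain ⟨v, hvV, hv⟩ := (dense_pi Set.univ fun (_ : Fin σ₀) _ => hD).inter_open_nonempty V hV hVne
  choose χ hχ hvχ using fun σ => hv σ (Set.mem_univ σ)
  -- The Gamma factor is chosen to cancel the limit `m'`.
  let ρ : Fin σ₀ → ℝ → ℂ := fun σ s => Complex.Gamma (1 - s * Complex.I) * χ σ s
  have hρ : ∀ σ, IntervalIntegrable (ρ σ) MeasureTheory.volume 1 2 := fun σ =>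
    (hχ σ).continuous_mul continuous_Gamma_one_sub
  have hρ' : ∀ σ (t : ℝ), IntervalIntegrable
      (fun s => Complex.exp (s * Complex.I * t) * ρ σ s) MeasureTheory.volume 1 2 := fun σ t =>
    (hρ σ).continuous_mul (by fun_prop)
  -- The phase is opposite to the oscillation of the eigenvalue of `T̃_{λ_σ}`: it makes `a σ n`
  -- itself negligible, yet disappears once that operator is applied.
  let a : Fin σ₀ → ℕ → HolSpace G := fun σ n =>
    HolSpace.mk (powInt L fun s => Complex.exp (s * Complex.I * Real.log (lam σ n)) * ρ σ s)
      (hdiff (hρ' σ _))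
  have ha : ∀ σ, Tendsto (a σ) atTop (𝓝 0) := by
    intro σ
    refine HolSpace.tendsto_mk _ fun K hK hKG => ?_
    rw [HolSpace.holFun_zero]
    exact tendstoUniformlyOn_powInt_riemannLebesgue hK (hL.mono hKG) (hρ σ)
      (tendsto_abs_atTop_atTop.comp (hlog σ))
  have hT : ∀ (n : ℕ) {ψ : ℝ → ℂ} (hψ : IntervalIntegrable ψ MeasureTheory.volume 1 2),
      tTilde G n (HolSpace.mk (powInt L ψ) (hdiff hψ)) =
        HolSpace.mk (powInt L fun s => taylorEigenvalue n (s * Complex.I) * ψ s)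
          (hdiff (hψ.continuous_mul (continuous_taylorEigenvalue n))) := fun n ψ hψ =>
    tTilde_mk _ _ fun z hz => taylorAtZero_powInt G.isOpen hL hexp hψ n hz
  have hf : ∀ τ, Tendsto (fun n => tTilde G (lam τ n) (HolSpace.mk (powInt L χ₀) (hdiff hχ₀)))
      atTop (𝓝 0) := by
    intro τ
    simp only [fun n => hT (lam τ n) hχ₀]
    refine HolSpace.tendsto_mk _ fun K hK hKG => ?_
    rw [HolSpace.holFun_zero]
    refine (tendstoUniformlyOn_powInt_exp_mul hK (hL.mono hKG) hχ₀ (hm τ) hm' (hmC τ) (hmlim τ)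
      (t := fun n => -Real.log (lam τ n)) ?_).congr (Eventually.of_forall fun n z _ => ?_)
    · simp only [abs_neg]
      exact tendsto_abs_atTop_atTop.comp (hlog τ)
    · congr 1
      funext s
      have : Complex.exp (s * Complex.I * (-Real.log (lam τ n) : ℝ)) *
          Complex.exp (s * Complex.I * Real.log (lam τ n)) = 1 := by
        rw [← Complex.exp_add]
        simp
      simp only [m]
      linear_combination (taylorEigenvalue (lam τ n) (s * Complex.I) * χ₀ s) * this
  -- On the diagonal the weight tends to `χ σ`. Off the diagonal a phase of frequency `log λ_σ - log
  -- λ_τ` remains; its absolute value tends to infinity in either order of `σ` and `τ`.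
  have hTa : ∀ τ σ, Tendsto (fun n => tTilde G (lam τ n) (a σ n)) atTop
      (𝓝 (if σ = τ then v τ else 0)) := by
    intro τ σ
    simp only [a, fun n => hT (lam τ n) (hρ' σ (Real.log (lam σ n)))]
    refine HolSpace.tendsto_mk _ fun K hK hKG => ?_
    by_cases hστ : σ = τ
    · subst hστ
      rw [if_pos rfl, hvχ]
      have h1 := tendstoUniformlyOn_powInt_mul hK (hL.mono hKG) (hρ σ) (hm σ) hm' (hmC σ) (hmlim σ)
      have h2 : (fun s => m' s * ρ σ s) = χ σ := by
        funext s
        exact inv_mul_cancel_left₀ (Gamma_one_sub_ne_zero s) _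
      rw [h2] at h1
      refine (h1.congr_right fun z hz => (HolSpace.holFun_mk _ _ (hKG hz)).symm).congr
        (Eventually.of_forall fun n z _ => ?_)
      simp only [m, mul_assoc]
    · rw [if_neg hστ, HolSpace.holFun_zero]
      refine (tendstoUniformlyOn_powInt_exp_mul hK (hL.mono hKG) (hρ σ) (hm τ) hm' (hmC τ)
        (hmlim τ) (t := fun n => Real.log (lam σ n) - Real.log (lam τ n)) ?_).congr
        (Eventually.of_forall fun n z _ => ?_)
      · rcases lt_or_gt_of_ne hστ with h | h
        · refine (tendsto_abs_atTop_atTop.comp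
            (tendsto_log_sub_log_of_ratio hpos hratio h)).congr fun n => ?_
          exact abs_sub_comm _ _
        · exact tendsto_abs_atTop_atTop.comp (tendsto_log_sub_log_of_ratio hpos hratio h)
      · congr 1
        funext s
        have : Complex.exp (s * Complex.I * (Real.log (lam σ n) - Real.log (lam τ n) : ℝ)) *
            Complex.exp (s * Complex.I * Real.log (lam τ n)) =
            Complex.exp (s * Complex.I * Real.log (lam σ n)) := by
          rw [← Complex.exp_add]
          congr 1
          push_cast
          ring
        simp only [m]
        linear_combination (taylorEigenvalue (lam τ n) (s * Complex.I) * ρ σ s) * this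
  let x : ℕ → HolSpace G := fun n => HolSpace.mk (powInt L χ₀) (hdiff hχ₀) + ∑ σ, a σ n
  have hx : Tendsto x atTop (𝓝 (HolSpace.mk (powInt L χ₀) (hdiff hχ₀))) := by
    have h1 := (tendsto_finsetSum Finset.univ fun σ _ => ha σ).const_add
      (HolSpace.mk (powInt L χ₀) (hdiff hχ₀))
    simpa using h1
  have hTx : Tendsto (fun n => tTildeTuple G (fun σ => lam σ n) (x n)) atTop (𝓝 v) := by
    rw [tendsto_pi_nhds]
    intro τ
    have h1 := (hf τ).add (tendsto_finsetSum Finset.univ fun σ _ => hTa τ σ)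
    simp only [Finset.sum_ite_eq', Finset.mem_univ, if_true, zero_add] at h1
    refine h1.congr fun n => ?_
    change _ = tTilde G (lam τ n) (x n)
    simp only [x, map_add, map_sum]
  obtain ⟨n, hn1, hn2⟩ := ((hx.eventually (hU.mem_nhds hfU)).and
    (hTx.eventually (hV.mem_nhds hvV))).exists
  exact ⟨n, x n, hn1, hn2⟩
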